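/- Let $q\ge 2$ and let $\pi_1(\Sigma_q)=\langle a_1,b_1,\dots,a_q,b_q \mid [a_1,b_1]\cdots[a_q,b_q]=1\rangle$, where $[a,b]=aba^{-1}b^{-1}$, be the fundamental group of the closed orientable surface $\Sigma_q$ of genus $q$, given by its standard presentation. A left order on a group $G$ is a total order $\preceq$ on $G$ such that $f\preceq h$ implies $gf\preceq gh$ for all $f,g,h\in G$. The set $\mathcal{LO}(G)$ of all left orders on $G$ carries the topology in which a neighbourhood basis of $\preceq$ is given by the sets $\{\preceq'\in\mathcal{LO}(G) : \mathrm{id}\prec' g_i \text{ for } i=1,\dots,n\}$, where $\{g_1,\dots,g_n\}$ runs over the finite sets of $\preceq$-positive elements of $G$. The group $G$ acts on $\mathcal{LO}(G)$ by conjugation: for $g\in G$ the order $\preceq_g$ is defined by $h\preceq_g k \iff ghg^{-1}\preceq gkg^{-1}$. Then there is a left order $\preceq$ on $\pi_1(\Sigma_q)$ whose orbit $\{\preceq_g : g\in\pi_1(\Sigma_q)\}$ under conjugation is dense in $\mathcal{LO}(\pi_1(\Sigma_q))$. -/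

import Mathlib

/-- A left order on a group `G`: a total order `le` (written `f ≼ h`) on `G` such that `f ≼ h`
implies `g * f ≼ g * h` for all `g`. -/
structure LeftOrder (G : Type*) [Group G] where
  /-- The order relation. -/
  le : G → G → Prop
  le_refl : ∀ f, le f f
  le_trans : ∀ f g h, le f g → le g h → le f h
  le_antisymm : ∀ f g, le f g → le g f → f = g
  le_total : ∀ f g, le f g ∨ le g f
  mul_le_mul_left : ∀ g f h, le f h → le (g * f) (g * h)

namespace LeftOrder

variable {G : Type*} [Group G]

/-- The strict relation of a left order. -/
def lt (o : LeftOrder G) (f g : G) : Prop := o.le f g ∧ f ≠ g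

@[ext]
theorem ext {o p : LeftOrder G} (h : ∀ f g, o.le f g ↔ p.le f g) : o = p := by
  cases o; cases p
  simp only [mk.injEq]
  funext f g
  exact propext (h f g)

/-- The topology of the space of left orders: the sets `{o | 1 ≺ g}`, for `g` in `G`, form a
subbasis, so that a neighbourhood basis of `o` is given by the sets
`{o' | 1 ≺' g₁, …, 1 ≺' gₙ}` with `g₁, …, gₙ` positive for `o`. -/
instance : TopologicalSpace (LeftOrder G) :=
  TopologicalSpace.generateFrom (Set.range fun g : G => {o : LeftOrder G | o.lt 1 g})

/-- The conjugate `≼_g` of a left order: `h ≼_g k` if and only if `g h g⁻¹ ≼ g k g⁻¹`. -/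
def conj (o : LeftOrder G) (g : G) : LeftOrder G where
  le h k := o.le (g * h * g⁻¹) (g * k * g⁻¹)
  le_refl _ := o.le_refl _
  le_trans _ _ _ := o.le_trans _ _ _
  le_antisymm h k h₁ h₂ := by simpa using o.le_antisymm _ _ h₁ h₂
  le_total _ _ := o.le_total _ _
  mul_le_mul_left x h k hk := by
    simpa [mul_assoc] using o.mul_le_mul_left (g * x * g⁻¹) _ _ hk

theorem conj_one (o : LeftOrder G) : o.conj 1 = o := by
  ext f g; simp [conj]

theorem conj_conj (o : LeftOrder G) (g h : G) : (o.conj g).conj h = o.conj (g * h) := by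
  ext x y; simp [conj, mul_assoc]

/-- The orbit of a left order under the conjugation action of the group. -/
def conjOrbit (o : LeftOrder G) : Set (LeftOrder G) := Set.range o.conj

end LeftOrder

/-- The relator `[a₁, b₁] [a₂, b₂] ⋯ [a_q, b_q]`, where `aᵢ` is the generator `Sum.inl i`, `bᵢ` is
the generator `Sum.inr i`, and `[a, b] = a b a⁻¹ b⁻¹`. -/
def surfaceRelator (q : ℕ) : FreeGroup (Fin q ⊕ Fin q) :=
  (List.ofFn fun i : Fin q =>
    FreeGroup.of (Sum.inl i) * FreeGroup.of (Sum.inr i) *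
      (FreeGroup.of (Sum.inl i))⁻¹ * (FreeGroup.of (Sum.inr i))⁻¹).prod

/-- The fundamental group of the closed orientable surface of genus `q`, given by its standard
presentation `⟨a₁, b₁, …, a_q, b_q | [a₁, b₁] ⋯ [a_q, b_q] = 1⟩`. -/
abbrev SurfaceGroup (q : ℕ) : Type :=
  PresentedGroup ({surfaceRelator q} : Set (FreeGroup (Fin q ⊕ Fin q)))

open Set Filter Topology

/-! ### The space of left orders and the Baire category argument. -/

namespace LeftOrder

variable {G : Type*} [Group G]

/-! The space of left orders is compact Hausdorff and the group is countable. By Baire it is enough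
that conjugation be topologically transitive: given finite sets positive for `o₁` and for `o₂`, some
order is positive on the first and has a conjugate positive on the second
(`exists_dense_conjOrbit`). An action on the line makes `g` positive when it moves a base point to
the right, and conjugating the order moves the base point inside its orbit. Every left order of a
countable group arises so (`exists_real_action`). Hence two actions, each seen from a base point to
finite precision, must be found at two points of one orbit of a single action
(`exists_joint_action`).

Finitely many words at a base point see the generators only on some half-line `(-∞, y]`. Further
right, the generators of all handles but the first are cut off to the identity, and the relation is
repaired by the first handle alone (`commutatorFlexible`): `[a', b'] = h` says that `a'` conjugates
`b'` to `h * b'`, and maps that push all points of a half-line towards `p` can be conjugated by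
extension from a fundamental domain. The repaired action is trivial past `p` and has no common fixed
point before `p`, so the orbit of the base point climbs past the support of the second handle. A
mirror image of the other action is placed to the right of `p`. Near `p` the second handle acts
trivially, so its `b` can be multiplied by a bump commuting with its `a`. This keeps the relation
and carries one orbit across `p`. A second handle, that is `q ≥ 2`, is essential here.

That left orders exist at all follows from embedding the surface group in a semidirect product of a
free group with `ℤ`. -/

theorem le_iff_lt_one (o : LeftOrder G) (f g : G) : o.le f g ↔ f = g ∨ o.lt 1 (f⁻¹ * g) := by
  constructor
  · intro h
    by_cases hfg : f = g
    · exact Or.inl hfg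
    · refine Or.inr ⟨by simpa using o.mul_le_mul_left f⁻¹ f g h, fun h1 => hfg ?_⟩
      exact inv_mul_eq_one.1 h1.symm
  · rintro (rfl | h)
    · exact o.le_refl _
    · simpa using o.mul_le_mul_left f _ _ h.1

theorem not_lt_one_one (o : LeftOrder G) : ¬ o.lt 1 1 := fun h => h.2 rfl

theorem lt_one_inv_iff (o : LeftOrder G) {g : G} (hg : g ≠ 1) : o.lt 1 g⁻¹ ↔ ¬ o.lt 1 g := by
  constructor
  · intro h h'
    have h1 := o.mul_le_mul_left g _ _ h.1
    rw [mul_one, mul_inv_cancel] at h1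
    exact hg (o.le_antisymm _ _ h1 h'.1)
  · intro h
    have h1 : o.le g 1 := (o.le_total g 1).resolve_right fun h' => h ⟨h', hg.symm⟩
    refine ⟨by simpa using o.mul_le_mul_left g⁻¹ _ _ h1, fun h' => hg ?_⟩
    exact inv_eq_one.1 h'.symm

theorem lt_one_mul (o : LeftOrder G) {g h : G} (hg : o.lt 1 g) (hh : o.lt 1 h) :
    o.lt 1 (g * h) := by
  have h1 : o.le g (g * h) := by simpa using o.mul_le_mul_left g _ _ hh.1
  refine ⟨o.le_trans _ _ _ hg.1 h1, fun h' => hg.2 ?_⟩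
  rw [← h'] at h1
  exact o.le_antisymm _ _ hg.1 h1

/-- The left order with a given positive cone. -/
def ofPos (P : G → Prop) (h1 : ¬ P 1) (hinv : ∀ g, g ≠ 1 → (P g⁻¹ ↔ ¬ P g))
    (hmul : ∀ g h, P g → P h → P (g * h)) : LeftOrder G where
  le f g := f = g ∨ P (f⁻¹ * g)
  le_refl _ := Or.inl rfl
  le_trans f g h := by
    rintro (rfl | hfg) (rfl | hgh)
    · exact Or.inl rfl
    · exact Or.inr hgh
    · exact Or.inr hfg
    · exact Or.inr (by simpa [mul_assoc] using hmul _ _ hfg hgh)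
  le_antisymm f g := by
    rintro (rfl | hfg) (h | hgf)
    · rfl
    · rfl
    · exact h.symm
    · exact absurd (by simpa [mul_assoc] using hmul _ _ hfg hgf) h1
  le_total f g := by
    by_cases hfg : f⁻¹ * g = 1
    · exact Or.inl (Or.inl (inv_mul_eq_one.1 hfg))
    · have := hinv _ hfg
      rw [mul_inv_rev, inv_inv] at this
      tauto
  mul_le_mul_left g f h := by
    rintro (rfl | hfh)
    · exact Or.inl rfl
    · exact Or.inr (by simpa [mul_assoc] using hfh)

theorem ofPos_lt (P : G → Prop) (h1 : ¬ P 1) (hinv : ∀ g, g ≠ 1 → (P g⁻¹ ↔ ¬ P g))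
    (hmul : ∀ g h, P g → P h → P (g * h)) (g : G) : (ofPos P h1 hinv hmul).lt 1 g ↔ P g := by
  simp only [lt, ofPos, inv_one, one_mul]
  constructor
  · rintro ⟨h | h, h'⟩
    · exact absurd h h'
    · exact h
  · exact fun h => ⟨Or.inr h, fun h' => h1 (h' ▸ h)⟩

theorem ext_lt {o p : LeftOrder G} (h : ∀ g, o.lt 1 g ↔ p.lt 1 g) : o = p := by
  ext f g
  rw [le_iff_lt_one, le_iff_lt_one, h]

theorem isOpen_lt_one (g : G) : IsOpen {o : LeftOrder G | o.lt 1 g} :=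
  TopologicalSpace.isOpen_generateFrom_of_mem ⟨g, rfl⟩

theorem isClopen_lt_one (g : G) : IsClopen {o : LeftOrder G | o.lt 1 g} := by
  refine ⟨⟨?_⟩, isOpen_lt_one g⟩
  by_cases hg : g = 1
  · subst hg
    convert isOpen_univ
    ext o
    simpa using o.not_lt_one_one
  · convert isOpen_lt_one g⁻¹
    ext o
    simp [o.lt_one_inv_iff hg]

open Classical in
/-- The indicator function of the positive cone. -/
noncomputable def posIndicator (o : LeftOrder G) (g : G) : Bool := decide (o.lt 1 g)

theorem posIndicator_eq_true (o : LeftOrder G) (g : G) :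
    o.posIndicator g = true ↔ o.lt 1 g := by simp [posIndicator]

/-- A left order is its positive cone, and being a cone is a conjunction of conditions on finitely
many coordinates each, hence closed in the product. Compactness and separation are inherited from `G
→ Bool`. -/
theorem isClosedEmbedding_posIndicator :
    IsClosedEmbedding (posIndicator : LeftOrder G → G → Bool) := by
  have hcont : Continuous (posIndicator : LeftOrder G → G → Bool) := by
    refine continuous_pi fun g => (continuous_bool_rng true).2 ?_
    convert isClopen_lt_one g using 1
    ext o
    simp [posIndicator_eq_true]
  have hcl (g : G) : IsClopen {P : G → Bool | P g = true} :=
    (isClopen_discrete {true}).preimage (continuous_apply g)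
  refine ⟨⟨⟨_root_.le_antisymm hcont.le_induced (le_generateFrom ?_)⟩, ?_⟩, ?_⟩
  · rintro _ ⟨g, rfl⟩
    refine ⟨{P | P g = true}, (hcl g).isOpen, ?_⟩
    ext o
    simp [posIndicator_eq_true]
  · intro o p h
    refine ext_lt fun g => ?_
    rw [← posIndicator_eq_true, ← posIndicator_eq_true, h]
  · have : range (posIndicator : LeftOrder G → G → Bool) =
        {P | P 1 = true}ᶜ ∩ (⋂ (g : G) (_ : g ≠ 1), {P | P g⁻¹ = true ↔ ¬ P g = true}) ∩
          ⋂ (g : G) (h : G), {P | P g = true → P h = true → P (g * h) = true} := by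
      ext P
      simp only [mem_range, mem_inter_iff, mem_compl_iff, mem_ofPred_eq, mem_iInter]
      constructor
      · rintro ⟨o, rfl⟩
        simp only [posIndicator_eq_true]
        exact ⟨⟨o.not_lt_one_one, fun g hg => o.lt_one_inv_iff hg⟩, fun g h => o.lt_one_mul⟩
      · rintro ⟨⟨h1, h2⟩, h3⟩
        refine ⟨ofPos (fun g => P g = true) h1 h2 h3, ?_⟩
        funext g
        rw [Bool.eq_iff_iff, posIndicator_eq_true, ofPos_lt]
    rw [this]
    refine ((hcl 1).isOpen.isClosed_compl.inter ?_).inter ?_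
    · refine isClosed_iInter fun g => isClosed_iInter fun _ => ?_
      have : {P : G → Bool | P g⁻¹ = true ↔ ¬ P g = true} =
          (fun P : G → Bool => (P g⁻¹, P g)) ⁻¹' {x | x.1 = true ↔ ¬ x.2 = true} := rfl
      rw [this]
      exact (isClosed_discrete _).preimage (by fun_prop)
    · refine isClosed_iInter fun g => isClosed_iInter fun h => ?_
      have : {P : G → Bool | P g = true → P h = true → P (g * h) = true} =
          (fun P : G → Bool => (P g, P h, P (g * h))) ⁻¹'
            {x | x.1 = true → x.2.1 = true → x.2.2 = true} := rfl
      rw [this]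
      exact (isClosed_discrete _).preimage (by fun_prop)

instance : CompactSpace (LeftOrder G) := isClosedEmbedding_posIndicator.compactSpace

instance : T2Space (LeftOrder G) := isClosedEmbedding_posIndicator.isEmbedding.t2Space

theorem exists_finset_of_isOpen {U : Set (LeftOrder G)} (hU : IsOpen U) {o : LeftOrder G}
    (ho : o ∈ U) :
    ∃ F : Finset G, (∀ g ∈ F, o.lt 1 g) ∧ ∀ p : LeftOrder G, (∀ g ∈ F, p.lt 1 g) → p ∈ U := by
  classical
  obtain ⟨_, ⟨S, ⟨hSfin, hS⟩, rfl⟩, hoS, hSU⟩ :=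
    (TopologicalSpace.isTopologicalBasis_of_subbasis
      (rfl : instTopologicalSpace = TopologicalSpace.generateFrom
        (range fun g : G => {o : LeftOrder G | o.lt 1 g}))).exists_subset_of_mem_open ho hU
  choose! c hc using hS
  refine ⟨hSfin.toFinset.image c, ?_, ?_⟩
  · intro g hg
    simp only [Finset.mem_image, Finite.mem_toFinset] at hg
    obtain ⟨s, hs, rfl⟩ := hg
    have := hoS s hs
    rw [← hc hs] at this
    exact this
  · intro p hp
    refine hSU fun s hs => ?_
    rw [← hc hs]
    exact hp _ (Finset.mem_image.2 ⟨s, by simpa using hs, rfl⟩)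

theorem conj_lt_one (o : LeftOrder G) (k g : G) : (o.conj k).lt 1 g ↔ o.lt 1 (k * g * k⁻¹) := by
  have : (1 : G) = k * g * k⁻¹ ↔ 1 = g := by
    rw [eq_comm, conj_eq_one_iff, eq_comm]
  simp [lt, conj, this]

/-- A topologically transitive conjugation action of a countable group has a dense orbit. -/
theorem exists_dense_conjOrbit [Countable G] [Nonempty (LeftOrder G)]
    (htrans : ∀ (o₁ o₂ : LeftOrder G) (F₁ F₂ : Finset G), (∀ g ∈ F₁, o₁.lt 1 g) →
      (∀ g ∈ F₂, o₂.lt 1 g) → ∃ (o : LeftOrder G) (k : G), (∀ g ∈ F₁, o.lt 1 g) ∧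
        ∀ g ∈ F₂, (o.conj k).lt 1 g) :
    ∃ o : LeftOrder G, Dense o.conjOrbit := by
  let B (F : Finset G) : Set (LeftOrder G) := {o | ∀ g ∈ F, o.lt 1 g}
  -- The premise makes `W F` the whole space when no order is positive on `F`, so that every `W F`
  -- is dense.
  let W (F : Finset G) : Set (LeftOrder G) := {o | (B F).Nonempty → ∃ k, o.conj k ∈ B F}
  have hWo (F : Finset G) : IsOpen (W F) := by
    by_cases hF : (B F).Nonempty
    · have : W F = ⋃ k : G, ⋂ g ∈ F, {o | o.lt 1 (k * g * k⁻¹)} := by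
        ext o
        simp [W, B, hF, conj_lt_one]
      rw [this]
      exact isOpen_iUnion fun k => isOpen_biInter_finset fun g _ => isOpen_lt_one _
    · have : W F = univ := by
        ext o
        simp [W, hF]
      rw [this]
      exact isOpen_univ
  have hWd (F : Finset G) : Dense (W F) := by
    refine dense_iff_inter_open.2 fun U hU ⟨o₁, ho₁⟩ => ?_
    obtain ⟨F₁, h₁, hF₁⟩ := exists_finset_of_isOpen hU ho₁
    by_cases hF : (B F).Nonempty
    · obtain ⟨o₂, h₂⟩ := hF
      obtain ⟨o, k, ho, hk⟩ := htrans o₁ o₂ F₁ F h₁ h₂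
      exact ⟨o, hF₁ o ho, fun _ => ⟨k, hk⟩⟩
    · exact ⟨o₁, ho₁, fun h => absurd h hF⟩
  -- Baire: a countable group has only countably many finite subsets.
  obtain ⟨o, ho⟩ := (dense_iInter_of_isOpen hWo hWd).nonempty
  refine ⟨o, dense_iff_inter_open.2 fun U hU ⟨o₂, ho₂⟩ => ?_⟩
  obtain ⟨F, h, hF⟩ := exists_finset_of_isOpen hU ho₂
  obtain ⟨k, hk⟩ := mem_iInter.1 ho F ⟨o₂, h⟩
  exact ⟨o.conj k, hF _ hk, k, rfl⟩

end LeftOrder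

/-! ### Increasing homeomorphisms of the line: gluing, cutting off, conjugating. -/

namespace LineHomeo

theorem exists_orderIso_of_strictMono {f : ℝ → ℝ} (hf : StrictMono f)
    (hs : Function.Surjective f) : ∃ k : ℝ ≃o ℝ, ∀ x, k x = f x :=
  ⟨hf.orderIsoOfSurjective f hs, fun _ => rfl⟩

theorem exists_glue (f g : ℝ ≃o ℝ) (m : ℝ) (h : f m = g m) :
    ∃ k : ℝ ≃o ℝ, (∀ x ≤ m, k x = f x) ∧ ∀ x, m ≤ x → k x = g x := by
  have hf : StrictMono (fun x => if x ≤ m then f x else g x) := by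
    intro x y hxy
    simp only
    split_ifs with h1 h2 h2
    · exact f.strictMono hxy
    · exact (f.monotone h1).trans_lt (h ▸ g.strictMono (not_le.1 h2))
    · exact absurd (hxy.le.trans h2) h1
    · exact g.strictMono hxy
  have hs : Function.Surjective (fun x => if x ≤ m then f x else g x) := by
    intro y
    rcases le_total y (f m) with hy | hy
    · exact ⟨f⁻¹ y, by beta_reduce; rw [if_pos (by simpa using f⁻¹.monotone hy)]; simp⟩
    · rcases hy.eq_or_lt with rfl | hy
      · exact ⟨m, by simp⟩
      · refine ⟨g⁻¹ y, ?_⟩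
        rw [h] at hy
        have : m < g⁻¹ y := by simpa using g⁻¹.strictMono hy
        beta_reduce
        rw [if_neg this.not_ge]
        simp
  obtain ⟨k, hk⟩ := exists_orderIso_of_strictMono hf hs
  refine ⟨k, fun x hx => by simp [hk, hx], fun x hx => ?_⟩
  rcases hx.eq_or_lt with rfl | hx
  · simp [hk, h]
  · simp [hk, hx.not_ge]

theorem exists_affine {c : ℝ} (hc : 0 < c) (m n : ℝ) :
    ∃ k : ℝ ≃o ℝ, ∀ x, k x = n + c * (x - m) := by
  refine exists_orderIso_of_strictMono (fun x y hxy => ?_) fun y => ⟨m + (y - n) / c, ?_⟩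
  · have := mul_lt_mul_of_pos_left (sub_lt_sub_right hxy m) hc
    linarith
  · field_simp
    ring

/-- Prolong `f`, past `m`, by the segment from `(m, f m)` to `(m', n')`. -/
theorem exists_join (f : ℝ ≃o ℝ) {m m' n' : ℝ} (hm : m < m') (hn : f m < n') :
    ∃ k : ℝ ≃o ℝ, (∀ x ≤ m, k x = f x) ∧ k m' = n' ∧
      ∀ x, m ≤ x → k x = f m + (n' - f m) / (m' - m) * (x - m) := by
  obtain ⟨g, hg⟩ := exists_affine (div_pos (sub_pos.2 hn) (sub_pos.2 hm)) m (f m)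
  obtain ⟨k, hk1, hk2⟩ := exists_glue f g m (by simp [hg])
  refine ⟨k, hk1, ?_, fun x hx => by rw [hk2 x hx, hg]⟩
  rw [hk2 m' hm.le, hg, div_mul_cancel₀ _ (sub_pos.2 hm).ne']
  ring

/-- Every increasing homeomorphism can be made trivial near `+∞` without changing it near `-∞`. -/
theorem exists_cutoff (f : ℝ ≃o ℝ) (m : ℝ) :
    ∃ (k : ℝ ≃o ℝ) (N : ℝ), (∀ x ≤ m, k x = f x) ∧ ∀ x, N ≤ x → k x = x := by
  obtain ⟨k, hk1, hk2, -⟩ := exists_join f (m' := max m (f m) + 1) (n' := max m (f m) + 1)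
    ((le_max_left _ _).trans_lt (lt_add_one _)) ((le_max_right _ _).trans_lt (lt_add_one _))
  obtain ⟨l, hl1, hl2⟩ := exists_glue k 1 (max m (f m) + 1) hk2
  refine ⟨l, _, fun x hx => ?_, hl2⟩
  rw [hl1 x (hx.trans ((le_max_left _ _).trans (lt_add_one _).le)), hk1 x hx]

/-- The supremum of an orbit bounded by `x` would be a point of `[y, p)` that `u` does not move to
the right. -/
theorem exists_le_pow_apply (u : ℝ ≃o ℝ) {y p : ℝ}
    (hu : ∀ x, y ≤ x → x < p → x < u x) {x : ℝ} (hx : x < p) : ∃ n : ℕ, x ≤ (u ^ n) y := by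
  by_contra! H
  have hbdd : BddAbove (range fun n : ℕ => (u ^ n) y) := ⟨x, by rintro _ ⟨n, rfl⟩; exact (H n).le⟩
  set s := sSup (range fun n : ℕ => (u ^ n) y) with hs
  have hsx : s ≤ x := csSup_le (range_nonempty _) (by rintro _ ⟨n, rfl⟩; exact (H n).le)
  have hys : y ≤ s := le_csSup hbdd ⟨0, by simp⟩
  have hus := hu s hys (hsx.trans_lt hx)
  have : u⁻¹ s < s := by simpa using u⁻¹.strictMono hus
  obtain ⟨_, ⟨n, rfl⟩, hn⟩ := exists_lt_of_lt_csSup (range_nonempty _) this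
  have h1 : s < (u ^ (n + 1)) y := by
    rw [pow_succ']
    simpa using u.strictMono hn
  exact absurd (le_csSup hbdd ⟨n + 1, rfl⟩) h1.not_ge

theorem pow_apply_of_fixed (u : ℝ ≃o ℝ) {p : ℝ} (hu : u p = p) (n : ℕ) : (u ^ n) p = p := by
  induction n with
  | zero => simp
  | succ n ih => rw [pow_succ]; simp [hu, ih]

/-- A conjugation between two homeomorphisms without fixed points, given on a fundamental domain,
extends equivariantly. -/
theorem exists_conj (a u v : ℝ ≃o ℝ) {y p : ℝ} (hy : y < p) (hay : a y < p)
    (hu : ∀ x, y ≤ x → x < p → x < u x) (hv : ∀ x, a y ≤ x → x < p → x < v x)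
    (hup : ∀ x, p ≤ x → u x = x) (hvp : ∀ x, p ≤ x → v x = x)
    (hc : ∀ x ≤ y, a (u x) = v (a x)) :
    ∃ a' : ℝ ≃o ℝ, (∀ x ≤ y, a' x = a x) ∧ (∀ x, p ≤ x → a' x = x) ∧
      ∀ x, a' (u x) = v (a' x) := by
  -- Equivariance forces this formula on `(-∞, u ^ n y]`. The formulas for different `n` agree where
  -- they overlap, and these half-lines exhaust `(-∞, p)`.
  let E (n : ℕ) (x : ℝ) : ℝ := (v ^ n) (a ((u ^ n)⁻¹ x))
  have hE : ∀ n, StrictMono (E n) := fun n x z hxz =>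
    (v ^ n).strictMono (a.strictMono ((u ^ n)⁻¹.strictMono hxz))
  have hle (n : ℕ) (x : ℝ) : (u ^ n)⁻¹ x ≤ y ↔ x ≤ (u ^ n) y := by
    rw [← (u ^ n).le_iff_le (x := (u ^ n)⁻¹ x)]
    simp
  have hstep (n : ℕ) {x : ℝ} (hx : x ≤ (u ^ n) y) : E (n + 1) x = E n x := by
    have h1 : (u ^ n)⁻¹ x ≤ y := (hle n x).2 hx
    have h2 : u⁻¹ ((u ^ n)⁻¹ x) ≤ y := by
      have := u⁻¹.monotone (h1.trans (hu y le_rfl hy).le)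
      simpa using this
    have h3 := hc _ h2
    simp only [RelIso.apply_inv_self] at h3
    change (v ^ (n + 1)) (a ((u ^ (n + 1))⁻¹ x)) = (v ^ n) (a ((u ^ n)⁻¹ x))
    have h4 : (u ^ (n + 1))⁻¹ x = u⁻¹ ((u ^ n)⁻¹ x) := by
      rw [pow_succ, mul_inv_rev]; simp
    rw [h4, h3, pow_succ]
    simp
  have hmono {n k : ℕ} (hnk : n ≤ k) : (u ^ n) y ≤ (u ^ k) y := by
    induction hnk with
    | refl => rfl
    | @step k _ ih =>
      refine ih.trans ?_
      rw [pow_succ]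
      simpa using (hu y le_rfl hy).le
  have hconst {n k : ℕ} (hnk : n ≤ k) {x : ℝ} (hx : x ≤ (u ^ n) y) : E k x = E n x := by
    induction hnk with
    | refl => rfl
    | @step k h ih => rw [hstep k (hx.trans (hmono h)), ih]
  have hesc : ∀ x, x < p → ∃ n : ℕ, x ≤ (u ^ n) y := fun x hx => exists_le_pow_apply u hu hx
  choose! N hN using hesc
  let A (x : ℝ) : ℝ := if x < p then E (N x) x else x
  have hA {x : ℝ} (hx : x < p) {n : ℕ} (hn : x ≤ (u ^ n) y) : A x = E n x := by
    simp only [A, if_pos hx]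
    rcases le_total n (N x) with h | h
    · exact hconst h hn
    · exact (hconst h (hN x hx)).symm
  have hAp {x : ℝ} (hx : p ≤ x) : A x = x := by simp [A, hx.not_gt]
  have hAlt {x : ℝ} (hx : x < p) : A x < p := by
    rw [hA hx (hN x hx)]
    have h1 : a ((u ^ N x)⁻¹ x) < p := (a.monotone ((hle _ _).2 (hN x hx))).trans_lt hay
    exact ((v ^ N x).strictMono h1).trans_eq (pow_apply_of_fixed v (hvp p le_rfl) _)
  have hf : StrictMono A := by
    intro x z hxz
    rcases lt_or_ge z p with hz | hz
    · rw [hA hz (hN z hz), hA (hxz.trans hz) (hxz.le.trans (hN z hz))]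
      exact hE _ hxz
    · rw [hAp hz]
      rcases lt_or_ge x p with hx | hx
      · exact (hAlt hx).trans_le hz
      · rwa [hAp hx]
  have hs : Function.Surjective A := by
    intro z
    rcases lt_or_ge z p with hz | hz
    · obtain ⟨n, hn⟩ := exists_le_pow_apply v hv hz
      have h1 : (v ^ n)⁻¹ z ≤ a y := by simpa using (v ^ n)⁻¹.monotone hn
      have h2 : a⁻¹ ((v ^ n)⁻¹ z) ≤ y := by simpa using a⁻¹.monotone h1
      refine ⟨(u ^ n) (a⁻¹ ((v ^ n)⁻¹ z)), ?_⟩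
      have h3 : (u ^ n) (a⁻¹ ((v ^ n)⁻¹ z)) < p :=
        ((u ^ n).strictMono (h2.trans_lt hy)).trans_eq (pow_apply_of_fixed u (hup p le_rfl) _)
      rw [hA h3 ((u ^ n).monotone h2)]
      simp [E]
    · exact ⟨z, hAp hz⟩
  obtain ⟨a', ha'⟩ := exists_orderIso_of_strictMono hf hs
  refine ⟨a', fun x hx => ?_, fun x hx => by rw [ha', hAp hx], fun x => ?_⟩
  · rw [ha', hA (hx.trans_lt hy) (n := 0) (by simpa using hx)]
    simp [E]
  · rw [ha', ha']
    rcases lt_or_ge x p with hx | hx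
    · have hux : u x < p := by
        simpa [hup p le_rfl] using u.strictMono hx
      have h1 : u x ≤ (u ^ (N x + 1)) y := by
        rw [pow_succ']
        simpa using hN x hx
      rw [hA hx (hN x hx), hA hux h1]
      change (v ^ (N x + 1)) (a ((u ^ (N x + 1))⁻¹ (u x))) = v ((v ^ N x) (a ((u ^ N x)⁻¹ x)))
      have h4 : (u ^ (N x + 1))⁻¹ (u x) = (u ^ N x)⁻¹ x := by
        rw [pow_succ', mul_inv_rev]; simp
      rw [h4, pow_succ']
      simp
    · rw [hup x hx, hAp hx, hvp x hx]

/-! ### Flexibility of commutators. -/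

/-- Any homeomorphism that agrees with `[a, b]` far enough to the left, and is trivial near `+∞`,
is a commutator of homeomorphisms that agree with `a` and `b` on `(-∞, y]`, are trivial near `+∞`,
and have no new common fixed points before that. -/
def CommutatorFlexible (a b : ℝ ≃o ℝ) (y : ℝ) : Prop :=
  ∃ z, y ≤ z ∧ ∀ (h : ℝ ≃o ℝ) (M : ℝ), (∀ x ≤ z, h x = (a * b * a⁻¹ * b⁻¹) x) →
    (∀ x, M ≤ x → h x = x) → ∃ (p : ℝ) (a' b' : ℝ ≃o ℝ), M < p ∧ (∀ x ≤ y, a' x = a x) ∧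
      (∀ x ≤ y, b' x = b x) ∧ (∀ x, p ≤ x → a' x = x) ∧ (∀ x, p ≤ x → b' x = x) ∧
      a' * b' * a'⁻¹ * b'⁻¹ = h ∧
      ∀ s < p, a' s = s → b' s = s → s ≤ z ∧ a s = s ∧ b s = s

theorem CommutatorFlexible.mono {a b : ℝ ≃o ℝ} {y y' : ℝ} (h : CommutatorFlexible a b y)
    (hy : y' ≤ y) : CommutatorFlexible a b y' := by
  obtain ⟨z, hz, H⟩ := h
  refine ⟨z, hy.trans hz, fun h M h1 h2 => ?_⟩
  obtain ⟨p, a', b', hp, ha, hb, H'⟩ := H h M h1 h2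
  exact ⟨p, a', b', hp, fun x hx => ha x (hx.trans hy), fun x hx => hb x (hx.trans hy), H'⟩

/-- `[b, a] = [a, b]⁻¹`, so the problem for `h` becomes that for `h⁻¹`. The threshold moves because
`h⁻¹` on `(-∞, z]` is read off from `h` on the image under `[a, b]`. -/
theorem CommutatorFlexible.swap {a b : ℝ ≃o ℝ} {y : ℝ} (h : CommutatorFlexible a b y) :
    CommutatorFlexible b a y := by
  obtain ⟨z, hz, H⟩ := h
  refine ⟨max z ((a * b * a⁻¹ * b⁻¹) z), hz.trans (le_max_left _ _), fun h M h1 h2 => ?_⟩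
  have hl : ∀ x ≤ z, h⁻¹ x = (a * b * a⁻¹ * b⁻¹) x := by
    intro x hx
    have h3 := h1 ((a * b * a⁻¹ * b⁻¹) x)
      (((a * b * a⁻¹ * b⁻¹).monotone hx).trans (le_max_right _ _))
    have h4 : (b * a * b⁻¹ * a⁻¹) ((a * b * a⁻¹ * b⁻¹) x) = x := by simp
    rw [h4] at h3
    conv_lhs => rw [← h3]
    simp
  have hr : ∀ x, M ≤ x → h⁻¹ x = x := by
    intro x hx
    conv_lhs => rw [← h2 x hx]
    simp
  obtain ⟨p, a', b', hp, ha, hb, ha1, hb1, hab, hs⟩ := H h⁻¹ M hl hr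
  refine ⟨p, b', a', hp, hb, ha, hb1, ha1, ?_, fun s hsp h3 h4 => ?_⟩
  · rw [← inv_inv h, ← hab]
    group
  · obtain ⟨h5, h6, h7⟩ := hs s hsp h4 h3
    exact ⟨h5.trans (le_max_left _ _), h7, h6⟩

theorem lt_apply_of_forall_ne {b : ℝ ≃o ℝ} {y m : ℝ} (hb : ∀ x, y ≤ x → x ≤ m → b x ≠ x)
    (hy : y < b y) {x : ℝ} (hx : y ≤ x) (hxm : x ≤ m) : x < b x := by
  by_contra! h
  obtain ⟨s, hs, hs'⟩ := isPreconnected_Icc.intermediate_value₂ (left_mem_Icc.2 hx)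
    (right_mem_Icc.2 hx) continuousOn_id b.continuous.continuousOn hy.le h
  exact hb s hs.1 (hs.2.trans hxm) hs'.symm

/-- The equation `[a', b'] = h` means `a' * b' = h * b' * a'`. So `b'` is chosen first, with both
`b'` and `h * b'` moving points to the right up to `p`, and `a'` is then the conjugation extending
`a`. Any common fixed point before `p` is then to the left of `y`, where nothing has changed. -/
theorem commutatorFlexible_of_lt {a b : ℝ ≃o ℝ} {y : ℝ}
    (hb : ∀ x, y ≤ x → x ≤ max (a y) (a⁻¹ y) → x < b x) : CommutatorFlexible a b y := by
  set m := max y (a y) with hm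
  have hym : y ≤ m := le_max_left _ _
  have haym : a y ≤ m := le_max_right _ _
  have hcase : (m = y ∧ a y ≤ y ∧ y ≤ a⁻¹ y) ∨ (m = a y ∧ y ≤ a y) := by
    rcases le_total (a y) y with h | h
    · refine Or.inl ⟨max_eq_left h, h, ?_⟩
      simpa using a⁻¹.monotone h
    · exact Or.inr ⟨max_eq_right h, h⟩
  have hbm : ∀ x, y ≤ x → x ≤ m → x < b x := by
    intro x h1 h2
    rcases hcase with ⟨h3, h4, h5⟩ | ⟨h3, h4⟩
    · exact hb x h1 (h2.trans ((h3.trans_le h5).trans (le_max_right _ _)))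
    · exact hb x h1 (h2.trans (h3.trans_le (le_max_left _ _)))
  have hvm : ∀ x, a y ≤ x → x ≤ m → x < a (b (a⁻¹ x)) := by
    intro x h1 h2
    have h6 : y ≤ a⁻¹ x := by simpa using a⁻¹.monotone h1
    have h7 : a⁻¹ x ≤ a⁻¹ m := a⁻¹.monotone h2
    have h8 : a⁻¹ x < b (a⁻¹ x) := by
      refine hb _ h6 (h7.trans ?_)
      rcases hcase with ⟨h3, h4, h5⟩ | ⟨h3, h4⟩
      · rw [h3]
        exact le_max_right _ _
      · rw [h3]
        simp [h4]
    simpa using a.strictMono h8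
  have hmb : m < b m := hbm m hym le_rfl
  -- On `(-∞, m]` the map `h * b` evaluates `h` only up to `b m`, and there equals `a * b * a⁻¹`.
  refine ⟨b m, hym.trans hmb.le, fun h M h1 h2 => ?_⟩
  have hhb : ∀ x ≤ m, h (b x) = a (b (a⁻¹ x)) := by
    intro x hx
    rw [h1 _ (b.monotone hx)]
    simp
  have hmt : m < min (b m) (h (b m)) := lt_min hmb (by
    rw [hhb m le_rfl]
    exact hvm m haym le_rfl)
  -- For `x` in `[m, t)`, both `b' x` and `h (b' x)` are at least `t`, whatever extension `b'` of
  -- `b` is taken.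
  set t := min (b m) (h (b m)) with ht
  have htb : t ≤ b m := min_le_left _ _
  set e := max M (b m) + 1 with he
  have hMe : M < e := (le_max_left _ _).trans_lt (lt_add_one _)
  have hbe : b m < e := (le_max_right _ _).trans_lt (lt_add_one _)
  have hep : e < e + 1 := lt_add_one _
  set p := e + 1 with hp
  have hte : t < e := htb.trans_lt hbe
  have htp : t < p := hte.trans hep
  -- After `m`, the graph of `b'` goes by segments through `(t, e)` and `(p, p)`, then follows the
  -- diagonal. From `t` on its values are at least `e > M`, where `h` is trivial.
  obtain ⟨k₁, hk₁, hk₁t, -⟩ := exists_join b hmt hbe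
  obtain ⟨k₂, hk₂, hk₂p, hk₂a⟩ := exists_join k₁ htp (n' := p) (hk₁t.trans_lt hep)
  obtain ⟨b', hb', hb'p⟩ := exists_glue k₂ 1 p hk₂p
  have hb'm : ∀ x ≤ m, b' x = b x := fun x hx => by
    rw [hb' x (hx.trans (hmt.trans htp).le), hk₂ x (hx.trans hmt.le), hk₁ x hx]
  have hb't : ∀ x, t ≤ x → x < p → x < b' x ∧ h (b' x) = b' x := by
    intro x hx hxp
    have h3 : b' x = e + (p - e) / (p - t) * (x - t) := by
      rw [hb' x hxp.le, hk₂a x hx, hk₁t]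
    have hpt : 0 < p - t := sub_pos.2 htp
    have hr0 : 0 < (p - e) / (p - t) := div_pos (sub_pos.2 hep) hpt
    have hr1 : (p - e) / (p - t) < 1 := by
      rw [div_lt_one hpt]
      linarith
    have hr : (p - e) / (p - t) * (p - t) = p - e := div_mul_cancel₀ _ hpt.ne'
    refine ⟨?_, h2 _ ?_⟩
    · rw [h3]
      nlinarith
    · rw [h3]
      nlinarith
  have hb'mt : ∀ x, m ≤ x → x < t → x < b' x ∧ x < h (b' x) := by
    intro x hx hxt
    have h3 : b m ≤ b' x := by
      rw [← hb'm m le_rfl]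
      exact b'.monotone hx
    exact ⟨hxt.trans_le (htb.trans h3), hxt.trans_le ((min_le_right _ _).trans (h.monotone h3))⟩
  have hu : ∀ x, y ≤ x → x < p → x < b' x := by
    intro x hx hxp
    rcases le_total x m with hxm | hxm
    · rw [hb'm x hxm]
      exact hbm x hx hxm
    · rcases lt_or_ge x t with hxt | hxt
      · exact (hb'mt x hxm hxt).1
      · exact (hb't x hxt hxp).1
  have hb'id : ∀ x, p ≤ x → b' x = x := fun x hx => by simp [hb'p x hx]
  obtain ⟨a', ha', ha'p, hconj⟩ := exists_conj a b' (h * b') (y := y) (p := p)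
    (hym.trans_lt (hmt.trans htp)) (haym.trans_lt (hmt.trans htp)) hu (by
      intro x hx hxp
      rw [RelIso.mul_apply]
      rcases le_total x m with hxm | hxm
      · rw [hb'm x hxm, hhb x hxm]
        exact hvm x hx hxm
      · rcases lt_or_ge x t with hxt | hxt
        · exact (hb'mt x hxm hxt).2
        · rw [(hb't x hxt hxp).2]
          exact (hb't x hxt hxp).1) hb'id (by
      intro x hx
      rw [RelIso.mul_apply, hb'id x hx, h2 x ((hMe.trans hep).le.trans hx)]) (by
      intro x hx
      have h3 : a x ≤ m := (a.monotone hx).trans haym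
      rw [RelIso.mul_apply, hb'm x (hx.trans hym), hb'm _ h3, hhb _ h3]
      simp)
  refine ⟨p, a', b', hMe.trans hep, ha', fun x hx => hb'm x (hx.trans hym), ha'p, hb'id, ?_, ?_⟩
  · have : a' * b' = h * b' * a' := by
      ext x
      exact hconj x
    rw [this]
    group
  · intro s hs h3 h4
    have hsy : s < y := by
      by_contra! h5
      exact (hu s h5 hs).ne' h4
    exact ⟨hsy.le.trans (hym.trans hmb.le), by rw [← ha' s hsy.le, h3],
      by rw [← hb'm s (hsy.le.trans hym), h4]⟩

/-- `[b a b⁻¹, b⁻¹] = [a, b]⁻¹`. This replaces `b` by `b⁻¹`, which reduces a `b` moving points to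
the left to the previous case. -/
theorem CommutatorFlexible.of_conj {a b : ℝ ≃o ℝ} {y : ℝ}
    (h : CommutatorFlexible (b * a * b⁻¹) b⁻¹ (b y)) :
    CommutatorFlexible a b (min y (a⁻¹ y)) := by
  obtain ⟨z, hz, H⟩ := h
  set c := a * b * a⁻¹ * b⁻¹ with hc
  refine ⟨max (max z (c⁻¹ z)) y, (min_le_left _ _).trans (le_max_right _ _), fun h M h1 h2 => ?_⟩
  have hl : ∀ x ≤ z, h⁻¹ x =
      (b * a * b⁻¹ * b⁻¹ * (b * a * b⁻¹)⁻¹ * b⁻¹⁻¹) x := by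
    intro x hx
    have h3 := h1 (c⁻¹ x) ((c⁻¹.monotone hx).trans ((le_max_right _ _).trans (le_max_left _ _)))
    rw [RelIso.apply_inv_self] at h3
    have h4 : (b * a * b⁻¹ * b⁻¹ * (b * a * b⁻¹)⁻¹ * b⁻¹⁻¹) = c⁻¹ := by
      rw [hc]
      group
    rw [h4]
    conv_lhs => rw [← h3]
    simp
  have hr : ∀ x, M ≤ x → h⁻¹ x = x := by
    intro x hx
    conv_lhs => rw [← h2 x hx]
    simp
  obtain ⟨p, a', u, hp, ha, hu, ha1, hu1, hab, hs⟩ := H h⁻¹ M hl hr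
  have hu' : ∀ x ≤ y, u⁻¹ x = b x := fun x hx => by
    have h3 := hu (b x) (b.monotone hx)
    simp only [RelIso.inv_apply_self] at h3
    conv_lhs => rw [← h3]
    simp
  have hu1' : ∀ x, p ≤ x → u⁻¹ x = x := fun x hx => by
    conv_lhs => rw [← hu1 x hx]
    simp
  -- The same identity read backwards. For `u * a' * u⁻¹` to agree with `a` at `x`, the point `b (a
  -- x)` must be at most `b y`, whence the bound `a⁻¹ y`.
  refine ⟨p, u * a' * u⁻¹, u⁻¹, hp, fun x hx => ?_, fun x hx => ?_, fun x hx => ?_, hu1', ?_, ?_⟩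
  · have hx1 : x ≤ y := hx.trans (min_le_left _ _)
    have hx2 : b (a x) ≤ b y := by
      have := a.monotone (hx.trans (min_le_right _ _))
      exact b.monotone (by simpa using this)
    simp only [RelIso.mul_apply]
    rw [hu' x hx1, ha _ (b.monotone hx1)]
    simp only [RelIso.mul_apply, RelIso.inv_apply_self]
    rw [hu _ hx2]
    simp
  · exact hu' x (hx.trans (min_le_left _ _))
  · simp only [RelIso.mul_apply]
    rw [hu1' x hx, ha1 x hx, hu1 x hx]
  · rw [← inv_inv h, ← hab]
    group
  · intro s hsp h3 h4
    have h5 : u s = s := by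
      conv_lhs => rw [← h4]
      simp
    have h6 : a' s = s := by
      simp only [RelIso.mul_apply] at h3
      rw [h4] at h3
      have : u (a' s) = u s := by rw [h3, h5]
      exact u.injective this
    obtain ⟨h7, h8, h9⟩ := hs s hsp h6 h5
    have h10 : b s = s := by
      conv_lhs => rw [← h9]
      simp
    refine ⟨h7.trans ((le_max_left _ _).trans (le_max_left _ _)), ?_, h10⟩
    simp only [RelIso.mul_apply] at h8
    rw [h9] at h8
    have : b (a s) = b s := by rw [h8, h10]
    exact b.injective this

theorem inv_apply_eq_self_iff {α : Type*} [LE α] (b : α ≃o α) (x : α) : b⁻¹ x = x ↔ b x = x := by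
  constructor <;> intro h <;> conv_lhs => rw [← h]
  · simp
  · simp

theorem commutatorFlexible_of_forall_ne {a b : ℝ ≃o ℝ} {y : ℝ}
    (hb : ∀ x, y ≤ x → x ≤ max (a y) (a⁻¹ y) → b x ≠ x) :
    CommutatorFlexible a b (min y (a⁻¹ y)) := by
  have hy : y ≤ max (a y) (a⁻¹ y) := by
    rcases le_total y (a y) with h | h
    · exact h.trans (le_max_left _ _)
    · have : y ≤ a⁻¹ y := by simpa using a⁻¹.monotone h
      exact this.trans (le_max_right _ _)
  rcases (hb y le_rfl hy).lt_or_gt with h | h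
  · refine CommutatorFlexible.of_conj (commutatorFlexible_of_lt fun x h1 h2 => ?_)
    have h3 : y ≤ b⁻¹ x := by simpa using b⁻¹.monotone h1
    have h4 : b⁻¹ x ≤ max (a y) (a⁻¹ y) := by
      have := b⁻¹.monotone h2
      rw [b⁻¹.monotone.map_max] at this
      simpa [mul_assoc] using this
    have h5 : y < b⁻¹ y := by simpa using b⁻¹.strictMono h
    have h6 := lt_apply_of_forall_ne (b := b⁻¹) (fun x hx hx' => by
      rw [ne_eq, inv_apply_eq_self_iff]
      exact hb x hx hx') h5 h3 h4
    simpa using b.strictMono h6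
  · exact (commutatorFlexible_of_lt fun x h1 h2 => lt_apply_of_forall_ne hb h h1 h2).mono
      (min_le_left _ _)

/-- Consider the first point `s ≥ r` fixed by `a` or by `b`. If only one of them fixes `s`, the
interval at `y = s` shrinks to `s`, which the other moves. If both do, `y = r` works, since `a r`
and `a⁻¹ r` stay before `s`. If there is no such point, `y = r` works too. -/
theorem exists_forall_ne (a b : ℝ ≃o ℝ) {r : ℝ} (hr : a r ≠ r) :
    ∃ y, r ≤ y ∧ ((∀ x, y ≤ x → x ≤ max (a y) (a⁻¹ y) → b x ≠ x) ∨
      ∀ x, y ≤ x → x ≤ max (b y) (b⁻¹ y) → a x ≠ x) := by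
  let S : Set ℝ := {s | r ≤ s ∧ (a s = s ∨ b s = s)}
  by_cases hS : S.Nonempty
  · have hbdd : BddBelow S := ⟨r, fun s hs => hs.1⟩
    have hcl : IsClosed S := by
      refine (isClosed_le continuous_const continuous_id).inter (IsClosed.union ?_ ?_)
      · exact isClosed_eq a.continuous continuous_id
      · exact isClosed_eq b.continuous continuous_id
    obtain ⟨hrs, hs⟩ := hcl.csInf_mem hS hbdd
    set s := sInf S
    by_cases has : a s = s
    · by_cases hbs : b s = s
      · have hlt : r < s := lt_of_le_of_ne hrs fun h => hr (by rw [h, has])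
        refine ⟨r, le_rfl, Or.inl fun x hx hx' hbx => ?_⟩
        have h1 : max (a r) (a⁻¹ r) < s := by
          have h2 : a⁻¹ s = s := (inv_apply_eq_self_iff a s).2 has
          exact max_lt ((a.strictMono hlt).trans_eq has) ((a⁻¹.strictMono hlt).trans_eq h2)
        exact (hx'.trans_lt h1).not_ge (csInf_le hbdd ⟨hx, Or.inr hbx⟩)
      · refine ⟨s, hrs, Or.inl fun x hx hx' => ?_⟩
        rw [has, (inv_apply_eq_self_iff a s).2 has, max_self] at hx'
        rwa [le_antisymm hx' hx]
    · have hbs := hs.resolve_left has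
      refine ⟨s, hrs, Or.inr fun x hx hx' => ?_⟩
      rw [hbs, (inv_apply_eq_self_iff b s).2 hbs, max_self] at hx'
      rwa [le_antisymm hx' hx]
  · exact ⟨r, le_rfl, Or.inl fun x hx _ hbx => hS ⟨x, hx, Or.inr hbx⟩⟩

theorem commutatorFlexible (a b : ℝ ≃o ℝ) (ha : ∀ y, ∃ r, y ≤ r ∧ a r ≠ r) (y : ℝ) :
    CommutatorFlexible a b y := by
  -- Starting beyond `a y` and `b y` absorbs the loss from `y` to `min y (a⁻¹ y)`, also with `a` and
  -- `b` exchanged.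
  obtain ⟨r, hyr, hr⟩ := ha (max y (max (a y) (b y)))
  simp only [max_le_iff] at hyr
  obtain ⟨s, hrs, hs | hs⟩ := exists_forall_ne a b hr
  · refine (commutatorFlexible_of_forall_ne hs).mono (le_min (hyr.1.trans hrs) ?_)
    simpa using a⁻¹.monotone (hyr.2.1.trans hrs)
  · refine (commutatorFlexible_of_forall_ne hs).swap.mono (le_min (hyr.1.trans hrs) ?_)
    simpa using b⁻¹.monotone (hyr.2.2.trans hrs)

/-! ### Evaluation of words in homeomorphisms. -/

section Words

variable {ι : Type*}

open FreeGroup (lift lift_apply_of)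

/-- The action of a word on a half-line depends only on the generators on some half-line. -/
theorem exists_lift_eqOn (f : ι → ℝ ≃o ℝ) (w : FreeGroup ι) (x : ℝ) :
    ∃ y, ∀ f' : ι → ℝ ≃o ℝ, (∀ i, ∀ z ≤ y, f' i z = f i z) →
      ∀ z ≤ x, lift f' w z = lift f w z := by
  induction w using FreeGroup.induction_on generalizing x with
  | C1 => exact ⟨0, by simp⟩
  | of i => exact ⟨x, fun f' h z hz => by simpa using h i z hz⟩
  | inv_of i _ =>
    refine ⟨(f i)⁻¹ x, fun f' h z hz => ?_⟩
    have h1 := h i ((f i)⁻¹ z) ((f i)⁻¹.monotone hz)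
    simp only [RelIso.apply_inv_self] at h1
    simp only [_root_.map_inv, lift_apply_of]
    conv_lhs => rw [← h1]
    simp
  | mul u v hu hv =>
    obtain ⟨y₁, h₁⟩ := hv x
    obtain ⟨y₂, h₂⟩ := hu (lift f v x)
    refine ⟨max y₁ y₂, fun f' h z hz => ?_⟩
    simp only [map_mul, RelIso.mul_apply]
    rw [h₁ f' (fun i w hw => h i w (hw.trans (le_max_left _ _))) z hz,
      h₂ f' (fun i w hw => h i w (hw.trans (le_max_right _ _))) _ ((lift f v).monotone hz)]

theorem lift_apply_eq_of_fixed {f f' : ι → ℝ ≃o ℝ} {S : Set ℝ} (hS : ∀ i, ∀ z ∈ S, f i z ∈ S)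
    (hS' : ∀ i, ∀ z ∈ S, (f i)⁻¹ z ∈ S) (h : ∀ i, ∀ z ∈ S, f' i z = f i z) (w : FreeGroup ι) :
    ∀ z ∈ S, lift f w z ∈ S ∧ lift f' w z = lift f w z := by
  induction w using FreeGroup.induction_on with
  | C1 => exact fun z hz => ⟨by simpa using hz, by simp⟩
  | of i => exact fun z hz => by simpa using ⟨hS i z hz, h i z hz⟩
  | inv_of i _ =>
    intro z hz
    simp only [_root_.map_inv, lift_apply_of]
    refine ⟨hS' i z hz, ?_⟩
    have h1 := h i _ (hS' i z hz)
    simp only [RelIso.apply_inv_self] at h1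
    conv_lhs => rw [← h1]
    simp
  | mul u v hu hv =>
    intro z hz
    simp only [map_mul, RelIso.mul_apply]
    obtain ⟨h1, h2⟩ := hv z hz
    obtain ⟨h3, h4⟩ := hu _ h1
    exact ⟨h3, by rw [h2, h4]⟩

theorem lift_apply_of_forall_fixed {f : ι → ℝ ≃o ℝ} {s : ℝ} (h : ∀ i, f i s = s)
    (w : FreeGroup ι) : lift f w s = s := by
  have := (lift_apply_eq_of_fixed (f := f) (f' := f) (S := {s}) (by simpa using h)
    (by simpa [inv_apply_eq_self_iff] using h) (by simp) w s rfl).1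
  simpa using this

end Words

open FreeGroup (lift lift_apply_of)

/-- If the generators `f'` have no common fixed point below `p`, some orbit point of `x` lies between
`M` and `p`, and it is reached in a way that is insensitive to changing `f' j` past its
fixed point `M`. -/
theorem exists_word_between {ι : Type*} (f' : ι → ℝ ≃o ℝ) (j : ι) {M p x : ℝ} (hx : x ≤ M)
    (hMp : M < p) (hfix : ∀ s < p, ∃ i, f' i s ≠ s) (hj : f' j M = M) (hp : ∀ i, f' i p = p) :
    ∃ (w : FreeGroup ι) (m : ℝ), M < m ∧ m < p ∧ ∀ f'' : ι → ℝ ≃o ℝ,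
      (∀ i, ∀ z ≤ M, f'' i z = f' i z) → (∀ i, i ≠ j → ∀ z ≤ p, f'' i z = f' i z) →
        lift f'' w x = m := by
  by_contra! H
  -- Orbit points up to `M` reached by words insensitive to the choice of `f''`. Some generator
  -- moves the supremum, so it or its inverse pushes a nearby point of `O` past it. The new point is
  -- before `p`, which is fixed: at most `M` it contradicts the supremum, beyond `M` it contradicts
  -- `H`.
  let O : Set ℝ := {o | o ≤ M ∧ ∃ w, ∀ f'' : ι → ℝ ≃o ℝ, (∀ i, ∀ z ≤ M, f'' i z = f' i z) →
    (∀ i, i ≠ j → ∀ z ≤ p, f'' i z = f' i z) → lift f'' w x = o}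
  have hxO : x ∈ O := ⟨hx, 1, fun f'' _ _ => by simp⟩
  have hbdd : BddAbove O := ⟨M, fun o ho => ho.1⟩
  have hmem : ∀ (w : FreeGroup ι) (m : ℝ), m < p → (∀ f'' : ι → ℝ ≃o ℝ,
      (∀ i, ∀ z ≤ M, f'' i z = f' i z) → (∀ i, i ≠ j → ∀ z ≤ p, f'' i z = f' i z) →
        lift f'' w x = m) → m ≤ sSup O := by
    intro w m hmp hw
    rcases le_or_gt m M with hm | hm
    · exact le_csSup hbdd ⟨hm, w, hw⟩
    · obtain ⟨f'', h1, h2, h3⟩ := H w m hm hmp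
      exact absurd (hw f'' h1 h2) h3
  have hsM : sSup O ≤ M := csSup_le ⟨x, hxO⟩ fun o ho => ho.1
  set s := sSup O with hs
  obtain ⟨i, hi⟩ := hfix s (hsM.trans_lt hMp)
  rcases hi.lt_or_gt with hi | hi
  · obtain ⟨o, ⟨hoM, w, hw⟩, ho⟩ := exists_lt_of_lt_csSup ⟨x, hxO⟩ hi
    have h1 : s < (f' i)⁻¹ o := by simpa using (f' i)⁻¹.strictMono ho
    have h2 : (f' i)⁻¹ o < p := by
      have := (f' i)⁻¹.strictMono (hoM.trans_lt hMp)
      rwa [(inv_apply_eq_self_iff _ _).2 (hp i)] at this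
    refine h1.not_ge (hmem ((FreeGroup.of i)⁻¹ * w) _ h2 fun f'' h3 h4 => ?_)
    simp only [map_mul, _root_.map_inv, lift_apply_of, RelIso.mul_apply, hw f'' h3 h4]
    have h5 : f'' i ((f' i)⁻¹ o) = o := by
      -- `f'' j` is known only up to `M`, but `f' j` fixes `M`, so the preimage of `o` stays there.
      by_cases hij : i = j
      · subst hij
        have := (f' i)⁻¹.monotone hoM
        rw [(inv_apply_eq_self_iff _ _).2 hj] at this
        rw [h3 i _ this]
        simp
      · rw [h4 i hij _ h2.le]
        simp
    conv_lhs => rw [← h5]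
    simp
  · have : (f' i)⁻¹ s < s := by simpa using (f' i)⁻¹.strictMono hi
    obtain ⟨o, ⟨hoM, w, hw⟩, ho⟩ := exists_lt_of_lt_csSup ⟨x, hxO⟩ this
    have h1 : s < f' i o := by simpa using (f' i).strictMono ho
    have h2 : f' i o < p := ((f' i).strictMono (hoM.trans_lt hMp)).trans_eq (hp i)
    refine h1.not_ge (hmem (FreeGroup.of i * w) _ h2 fun f'' h3 h4 => ?_)
    simp only [map_mul, lift_apply_of, RelIso.mul_apply, hw f'' h3 h4]
    exact h3 i o hoM

end LineHomeo

/-! ### The surface relator with its first handle split off. -/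

section

open FreeGroup (lift)

/-- The product of all but the first commutator in the surface relator. -/
def surfaceTail (n : ℕ) : FreeGroup (Fin (n + 1) ⊕ Fin (n + 1)) :=
  (List.ofFn fun i : Fin n =>
    FreeGroup.of (Sum.inl i.succ) * FreeGroup.of (Sum.inr i.succ) *
      (FreeGroup.of (Sum.inl i.succ))⁻¹ * (FreeGroup.of (Sum.inr i.succ))⁻¹).prod

theorem lift_surfaceTail {H : Type*} [Group H] (n : ℕ) (f : Fin (n + 1) ⊕ Fin (n + 1) → H) :
    lift f (surfaceTail n) = (List.ofFn fun i : Fin n =>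
      f (Sum.inl i.succ) * f (Sum.inr i.succ) * (f (Sum.inl i.succ))⁻¹ *
        (f (Sum.inr i.succ))⁻¹).prod := by
  simp [surfaceTail, map_list_prod, List.map_ofFn, Function.comp_def]

theorem lift_surfaceRelator {H : Type*} [Group H] (n : ℕ) (f : Fin (n + 1) ⊕ Fin (n + 1) → H) :
    lift f (surfaceRelator (n + 1)) = f (Sum.inl 0) * f (Sum.inr 0) * (f (Sum.inl 0))⁻¹ *
      (f (Sum.inr 0))⁻¹ * lift f (surfaceTail n) := by
  simp [surfaceRelator, surfaceTail, List.ofFn_succ]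

end

/-! ### Joining two actions of a surface group. -/

namespace LineHomeo

open FreeGroup (lift lift_apply_of)

/-- One half of the joint action: the words of `F` act on `x` as before, all is trivial past `p`,
the second handle is trivial already past `M`, and the orbit of `x` enters `(M, p)`. The last clause
lets the second `b` be altered past `M` without disturbing any of this. -/
theorem exists_left_piece (n : ℕ) (f : Fin (n + 2) ⊕ Fin (n + 2) → ℝ ≃o ℝ)
    (hrel : lift f (surfaceRelator (n + 2)) = 1) (hfix : ∀ s, ∃ i, f i s ≠ s)
    (ha : ∀ y, ∃ r, y ≤ r ∧ f (Sum.inl 0) r ≠ r) (x : ℝ)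
    (F : Finset (FreeGroup (Fin (n + 2) ⊕ Fin (n + 2)))) :
    ∃ (f' : Fin (n + 2) ⊕ Fin (n + 2) → ℝ ≃o ℝ) (M p m : ℝ)
      (w₀ : FreeGroup (Fin (n + 2) ⊕ Fin (n + 2))), M < m ∧ m < p ∧
      lift f' (surfaceRelator (n + 2)) = 1 ∧ (∀ i z, p ≤ z → f' i z = z) ∧
      (∀ z, M ≤ z → f' (Sum.inl 1) z = z ∧ f' (Sum.inr 1) z = z) ∧
      ∀ f'' : Fin (n + 2) ⊕ Fin (n + 2) → ℝ ≃o ℝ, (∀ i, ∀ z ≤ M, f'' i z = f' i z) →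
        (∀ i, i ≠ Sum.inr 1 → ∀ z ≤ p, f'' i z = f' i z) →
        (∀ w ∈ F, lift f'' w x = lift f w x) ∧ lift f'' w₀ x = m := by
  classical
  choose Y hY using fun w => exists_lift_eqOn f w x
  obtain ⟨y₀, hy₀⟩ := (F.image Y).exists_le
  set y := max y₀ x
  obtain ⟨z, hyz, hz⟩ := commutatorFlexible (f (Sum.inl 0)) (f (Sum.inr 0)) ha y
  obtain ⟨L₀, hL₀⟩ := exists_lift_eqOn f (surfaceTail (n + 1))⁻¹ z
  set L := max L₀ z
  choose k N hkL hkN using fun i => exists_cutoff (f i) L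
  obtain ⟨N₀, hN₀⟩ := (Finset.univ.image N).exists_le
  set M := max N₀ L
  have hkM : ∀ i w, M ≤ w → k i w = w := fun i w hw => hkN i w
    ((hN₀ _ (Finset.mem_image_of_mem _ (Finset.mem_univ i))).trans ((le_max_left _ _).trans hw))
  have hyL : y ≤ L := hyz.trans (le_max_right _ _)
  have hLM : L ≤ M := le_max_right _ _
  -- The inverse tail of the cut-off generators equals `[a, b]` of the original first handle up to
  -- `z`, by the relation, and is trivial past `M`.
  obtain ⟨p, a', b', hMp, haL, hbL, hap, hbp, hab, hs⟩ :=
    hz (lift k (surfaceTail (n + 1))⁻¹) M (by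
      intro w hw
      rw [hL₀ k (fun i v hv => hkL i v (hv.trans (le_max_left _ _))) w hw, _root_.map_inv]
      rw [lift_surfaceRelator] at hrel
      rw [eq_inv_of_mul_eq_one_left hrel]) (fun w hw =>
      lift_apply_of_forall_fixed (fun i => hkM i w hw) _)
  let f' : Fin (n + 2) ⊕ Fin (n + 2) → ℝ ≃o ℝ :=
    Sum.elim (Fin.cons a' fun i => k (Sum.inl i.succ)) (Fin.cons b' fun i => k (Sum.inr i.succ))
  have hcases : ∀ P : Fin (n + 2) ⊕ Fin (n + 2) → (ℝ ≃o ℝ) → Prop, P (Sum.inl 0) a' →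
      P (Sum.inr 0) b' → (∀ i, P i (k i)) → ∀ i, P i (f' i) := by
    intro P h1 h2 h3 i
    rcases i with i | i <;> refine Fin.cases ?_ (fun i => ?_) i
    · exact h1
    · exact h3 _
    · exact h2
    · exact h3 _
  have hf'y : ∀ i, ∀ v ≤ y, f' i v = f i v :=
    hcases (fun i g => ∀ v ≤ y, g v = f i v) haL hbL fun i v hv => hkL i v (hv.trans hyL)
  have hf'p : ∀ i, ∀ v, p ≤ v → f' i v = v :=
    hcases (fun i g => ∀ v, p ≤ v → g v = v) hap hbp fun i v hv => hkM i v (hMp.le.trans hv)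
  have hM1 : ∀ v, M ≤ v → f' (Sum.inl 1) v = v ∧ f' (Sum.inr 1) v = v :=
    fun v hv => ⟨hkM (Sum.inl 1) v hv, hkM (Sum.inr 1) v hv⟩
  have hf'fix : ∀ s < p, ∃ i, f' i s ≠ s := by
    intro s hsp
    by_contra! h
    -- A common fixed point of the new first handle before `p` is at most `z`, where the cut-off
    -- generators are the original ones. It would be fixed by the whole original action.
    obtain ⟨h1, h2, h3⟩ := hs s hsp (h (Sum.inl 0)) (h (Sum.inr 0))
    obtain ⟨i, hi⟩ := hfix s
    refine hi ?_
    have h4 : ∀ i, k i s = f i s := fun i => hkL i s (h1.trans (le_max_right _ _))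
    rcases i with i | i <;> revert hi <;> refine Fin.cases ?_ (fun i => ?_) i <;> intro _
    · exact h2
    · rw [← h4]
      exact h (Sum.inl i.succ)
    · exact h3
    · rw [← h4]
      exact h (Sum.inr i.succ)
  have hyM : y ≤ M := hyL.trans hLM
  obtain ⟨w₀, m, hMm, hmp, hw₀⟩ := exists_word_between f' (Sum.inr 1)
    ((le_max_right _ _).trans hyM) hMp hf'fix (hM1 M le_rfl).2 fun i => hf'p i p le_rfl
  refine ⟨f', M, p, m, w₀, hMm, hmp, ?_, hf'p, hM1, fun f'' h1 h2 => ⟨fun w hw => ?_, hw₀ f'' h1 h2⟩⟩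
  · have htail : lift f' (surfaceTail (n + 1)) = lift k (surfaceTail (n + 1)) := by
      rw [lift_surfaceTail, lift_surfaceTail]
      rfl
    rw [lift_surfaceRelator, htail]
    change a' * b' * a'⁻¹ * b'⁻¹ * _ = 1
    rw [hab, _root_.map_inv, inv_mul_cancel]
  · refine hY w f'' (fun i v hv => ?_) x le_rfl
    have hvy : v ≤ y :=
      hv.trans ((hy₀ _ (Finset.mem_image_of_mem _ hw)).trans (le_max_left _ _))
    rw [h1 i v (hvy.trans hyM), hf'y i v hvy]

/-- Conjugation by the reflection `x ↦ c - x`. -/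
def reflect (c : ℝ) : (ℝ ≃o ℝ) →* (ℝ ≃o ℝ) where
  toFun f :=
    { toFun x := c - f (c - x)
      invFun x := c - f⁻¹ (c - x)
      left_inv x := by simp
      right_inv x := by simp
      map_rel_iff' {a b} := by
        change c - f (c - a) ≤ c - f (c - b) ↔ a ≤ b
        rw [sub_le_sub_iff_left, f.le_iff_le, sub_le_sub_iff_left] }
  map_one' := by ext x; change c - (c - x) = x; ring
  map_mul' f g := by
    ext x
    change c - f (g (c - x)) = c - f (c - (c - g (c - x)))
    rw [sub_sub_cancel]

theorem reflect_apply (c : ℝ) (f : ℝ ≃o ℝ) (x : ℝ) : reflect c f x = c - f (c - x) := rfl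

theorem lift_reflect {ι : Type*} (c : ℝ) (f : ι → ℝ ≃o ℝ) (w : FreeGroup ι) :
    lift (fun i => reflect c (f i)) w = reflect c (lift f w) := by
  have : lift (fun i => reflect c (f i)) = (reflect c).comp (lift f) := by
    ext i : 1
    simp
  rw [this]
  rfl

theorem exists_bump {a b c d : ℝ} (hab : a < b) (hbd : b < d) (hac : a < c) (hcd : c < d) :
    ∃ k : ℝ ≃o ℝ, (∀ x ≤ a, k x = x) ∧ (∀ x, d ≤ x → k x = x) ∧ k b = c := by
  obtain ⟨k₁, h₁, h₁', -⟩ := exists_join 1 hab (n' := c) (by simpa using hac)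
  obtain ⟨k₂, h₂, h₂', -⟩ := exists_join k₁ hbd (n' := d) (by simpa [h₁'] using hcd)
  obtain ⟨k, hk, hk'⟩ := exists_glue k₂ 1 d h₂'
  refine ⟨k, fun x hx => ?_, fun x hx => by simp [hk' x hx], ?_⟩
  · rw [hk x (hx.trans (hab.trans hbd).le), h₂ x (hx.trans hab.le), h₁ x hx]
    simp
  · rw [hk b hbd.le, h₂ b le_rfl, h₁']

theorem mul_comm_of_fixed {A B : ℝ ≃o ℝ} {a d : ℝ} (hA : ∀ x, a ≤ x → x ≤ d → A x = x)
    (hB : ∀ x ≤ a, B x = x) (hB' : ∀ x, d ≤ x → B x = x) (had : a ≤ d) : A * B = B * A := by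
  ext x
  simp only [RelIso.mul_apply]
  rcases le_total x a with hx | hx
  · rw [hB x hx, hB]
    exact (A.monotone hx).trans_eq (hA a le_rfl had)
  · rcases le_total x d with hxd | hxd
    · rw [hA x hx hxd, hA]
      · exact (hB a le_rfl).symm.trans_le (B.monotone hx)
      · exact (B.monotone hxd).trans_eq (hB' d le_rfl)
    · rw [hB' x hxd, hB']
      exact (hA d had le_rfl).symm.trans_le (A.monotone hxd)

/-- Two actions of a surface group on the line can be realised, up to finite precision, in a single
action, on two points of the same orbit. -/
theorem exists_joint_action (n : ℕ) (f g : Fin (n + 2) ⊕ Fin (n + 2) → ℝ ≃o ℝ)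
    (hf : lift f (surfaceRelator (n + 2)) = 1) (hg : lift g (surfaceRelator (n + 2)) = 1)
    (hffix : ∀ s, ∃ i, f i s ≠ s) (hgfix : ∀ s, ∃ i, g i s ≠ s)
    (hfa : ∀ y, ∃ r, y ≤ r ∧ f (Sum.inl 0) r ≠ r) (hga : ∀ y, ∃ r ≤ y, g (Sum.inl 0) r ≠ r)
    (x x' : ℝ) (F F' : Finset (FreeGroup (Fin (n + 2) ⊕ Fin (n + 2))))
    (hF : ∀ w ∈ F, x < lift f w x) (hF' : ∀ w ∈ F', x' < lift g w x') :
    ∃ φ : Fin (n + 2) ⊕ Fin (n + 2) → ℝ ≃o ℝ, lift φ (surfaceRelator (n + 2)) = 1 ∧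
      (∀ w ∈ F, x < lift φ w x) ∧ ∃ W, ∀ w ∈ F', lift φ W x < lift φ w (lift φ W x) := by
  classical
  obtain ⟨f₁, M₁, p₁, m₁, w₁, hMm₁, hmp₁, hrel₁, hid₁, hM₁, hagree₁⟩ :=
    exists_left_piece n f hf hffix hfa x F
  obtain ⟨f₂, M₂, p₂, m₂, w₂, hMm₂, hmp₂, hrel₂, hid₂, hM₂, hagree₂⟩ :=
    exists_left_piece n (fun i => reflect 0 (g i)) (by rw [lift_reflect, hg, map_one])
      (fun s => by
        obtain ⟨i, hi⟩ := hgfix (-s)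
        refine ⟨i, fun h => hi ?_⟩
        rw [reflect_apply] at h
        simp only [zero_sub] at h
        linarith)
      (fun y => by
        obtain ⟨r, hr, hr'⟩ := hga (-y)
        refine ⟨-r, by linarith, fun h => hr' ?_⟩
        rw [reflect_apply] at h
        simp only [zero_sub, neg_neg] at h
        linarith) (-x') F'
  -- The reflection `x ↦ c - x` takes `p₂` to `p₁`, so the second piece becomes trivial on `(-∞,
  -- p₁]`. Composed with `x ↦ -x` it is a translation, so the base point `x'` becomes `c + x'`.
  set c := p₁ + p₂ with hc
  let g₂ : Fin (n + 2) ⊕ Fin (n + 2) → ℝ ≃o ℝ := fun i => reflect c (f₂ i)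
  have hg₂ : ∀ i z, z ≤ p₁ → g₂ i z = z := fun i z hz => by
    change c - f₂ i (c - z) = z
    rw [hid₂ i _ (by linarith)]
    ring
  let φ₀ : Fin (n + 2) ⊕ Fin (n + 2) → ℝ ≃o ℝ := fun i => f₁ i * g₂ i
  have hφ₀l : ∀ i, ∀ z ≤ p₁, φ₀ i z = f₁ i z := fun i z hz => by
    simp only [φ₀, RelIso.mul_apply, hg₂ i z hz]
  have hφ₀r : ∀ i, ∀ z, p₁ ≤ z → φ₀ i z = g₂ i z := fun i z hz => by
    simp only [φ₀, RelIso.mul_apply]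
    exact hid₁ i _ ((hg₂ i p₁ le_rfl).symm.trans_le ((g₂ i).monotone hz))
  have hrel₀ : lift φ₀ (surfaceRelator (n + 2)) = 1 := by
    ext z
    rcases le_total z p₁ with hz | hz
    · rw [(lift_apply_eq_of_fixed (f := f₁) (f' := φ₀) (S := Iic p₁) ?_ ?_ hφ₀l _ z hz).2, hrel₁]
      · exact fun i z hz => ((f₁ i).monotone hz).trans_eq (hid₁ i p₁ le_rfl)
      · exact fun i z hz => ((f₁ i)⁻¹.monotone hz).trans_eq
          ((inv_apply_eq_self_iff _ _).2 (hid₁ i p₁ le_rfl))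
    · rw [(lift_apply_eq_of_fixed (f := g₂) (f' := φ₀) (S := Ici p₁) ?_ ?_ hφ₀r _ z hz).2,
        lift_reflect, hrel₂, map_one]
      · exact fun i z hz => (hg₂ i p₁ le_rfl).symm.trans_le ((g₂ i).monotone hz)
      · exact fun i z hz => ((inv_apply_eq_self_iff _ _).2 (hg₂ i p₁ le_rfl)).symm.trans_le
          ((g₂ i)⁻¹.monotone hz)
  have h1 : m₁ < c - m₂ := by linarith
  -- `β` carries `m₁ < p₁` to `c - m₂ > p₁`. Its support lies in `[M₁, c - M₂]`, where both
  -- generators of the second handle act trivially under `φ₀`.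
  obtain ⟨β, hβl, hβr, hβm⟩ := exists_bump (a := M₁) (b := m₁) (c := c - m₂) (d := c - M₂)
    hMm₁ (by linarith) (by linarith) (by linarith)
  have hfixed : ∀ z, M₁ ≤ z → z ≤ c - M₂ → φ₀ (Sum.inl 1) z = z ∧ φ₀ (Sum.inr 1) z = z := by
    intro z hz hz'
    have h2 := hM₂ (c - z) (by linarith)
    have h3 : g₂ (Sum.inl 1) z = z ∧ g₂ (Sum.inr 1) z = z := by
      simp only [g₂, reflect_apply, h2]
      simp
    simp only [φ₀, RelIso.mul_apply, h3]
    exact hM₁ z hz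
  have hcomm : φ₀ (Sum.inl 1) * β = β * φ₀ (Sum.inl 1) :=
    mul_comm_of_fixed (fun z hz hz' => (hfixed z hz hz').1) hβl hβr (by linarith)
  let φ : Fin (n + 2) ⊕ Fin (n + 2) → ℝ ≃o ℝ :=
    fun i => φ₀ i * if i = Sum.inr 1 then β else 1
  have hφne : ∀ i, i ≠ Sum.inr 1 → φ i = φ₀ i := fun i hi => by simp [φ, hi]
  have hφ1 : φ (Sum.inr 1) = φ₀ (Sum.inr 1) * β := by simp [φ]
  have hφβ : ∀ i z, β z = z → φ i z = φ₀ i z := by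
    intro i z hz
    by_cases hi : i = Sum.inr 1
    · rw [hi, hφ1, RelIso.mul_apply, hz]
    · rw [hφne i hi]
  have hrel : lift φ (surfaceRelator (n + 2)) = 1 := by
    rw [← hrel₀, lift_surfaceRelator, lift_surfaceRelator, lift_surfaceTail, lift_surfaceTail,
      hφne (Sum.inl 0) (by simp), hφne (Sum.inr 0) (by simp)]
    congr 3
    funext i
    rw [hφne (Sum.inl i.succ) (by simp)]
    by_cases hi : (Sum.inr i.succ : Fin (n + 2) ⊕ Fin (n + 2)) = Sum.inr 1
    · have hi' : i.succ = 1 := Sum.inr_injective hi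
      rw [hi', hφ1]
      have h4 : φ₀ (Sum.inl 1) * (φ₀ (Sum.inr 1) * β) * (φ₀ (Sum.inl 1))⁻¹ *
          (φ₀ (Sum.inr 1) * β)⁻¹ = φ₀ (Sum.inl 1) * φ₀ (Sum.inr 1) * (β * (φ₀ (Sum.inl 1))⁻¹ *
            β⁻¹) * (φ₀ (Sum.inr 1))⁻¹ := by group
      have h5 : β * (φ₀ (Sum.inl 1))⁻¹ * β⁻¹ = (φ₀ (Sum.inl 1))⁻¹ := by
        rw [mul_inv_eq_iff_eq_mul, mul_inv_eq_iff_eq_mul, mul_assoc, ← hcomm]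
        group
      rw [h4, h5]
    · rw [hφne _ hi]
  obtain ⟨hA₁, hw₁⟩ := hagree₁ φ
    (fun i z hz => by rw [hφβ i z (hβl z hz), hφ₀l i z (by linarith)])
    (fun i hi z hz => by rw [hφne i hi, hφ₀l i z hz])
  have hrefl : ∀ i, ∀ z ≤ p₂, reflect c (φ₀ i) z = f₂ i z := by
    intro i z hz
    rw [reflect_apply, hφ₀r i _ (by linarith)]
    simp [g₂, reflect_apply]
  obtain ⟨hA₂, hw₂⟩ := hagree₂ (fun i => reflect c (φ i))
    (fun i z hz => by
      rw [reflect_apply, hφβ i _ (hβr _ (by linarith)), ← reflect_apply, hrefl i z (by linarith)])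
    (fun i hi z hz => by rw [hφne i hi, hrefl i z hz])
  have hx' : ∀ w, lift (fun i => reflect c (φ i)) w (-x') = c - lift φ w (c + x') := fun w => by
    rw [lift_reflect, reflect_apply, sub_neg_eq_add]
  -- `w₁` takes `x` to `m₁`, `β` carries it across `p₁` to `c - m₂`, which the old `b` of the second
  -- handle fixes, and `w₂⁻¹` leads on to `c + x'`.
  have hW : lift φ (w₂⁻¹ * (FreeGroup.of (Sum.inr 1) * w₁)) x = c + x' := by
    rw [hx'] at hw₂
    have h6 : lift φ w₂ (c + x') = c - m₂ := by linarith
    simp only [map_mul, _root_.map_inv, lift_apply_of, RelIso.mul_apply, hw₁, hφ1, hβm]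
    rw [(hfixed (c - m₂) (by linarith) (by linarith)).2, ← h6]
    simp
  refine ⟨φ, hrel, fun w hw => (hF w hw).trans_eq (hA₁ w hw).symm,
    w₂⁻¹ * (FreeGroup.of (Sum.inr 1) * w₁), fun w hw => ?_⟩
  · rw [hW]
    have h7 := hA₂ w hw
    rw [hx', lift_reflect, reflect_apply] at h7
    have h8 := hF' w hw
    simp only [zero_sub, neg_neg] at h7
    linarith

end LineHomeo

/-! ### From left orders to actions on the line and back. -/

/-- The monotone extension to `ℝ` of an increasing map of `ℚ`. -/
noncomputable def ratExtend (f : ℚ ≃o ℚ) (x : ℝ) : ℝ :=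
  sSup ((fun q : ℚ => (f q : ℝ)) '' {q : ℚ | (q : ℝ) ≤ x})

theorem ratExtend_nonempty (f : ℚ ≃o ℚ) (x : ℝ) :
    ((fun q : ℚ => (f q : ℝ)) '' {q : ℚ | (q : ℝ) ≤ x}).Nonempty := by
  obtain ⟨q, hq⟩ := exists_rat_lt x
  exact ⟨_, q, hq.le, rfl⟩

theorem ratExtend_bddAbove (f : ℚ ≃o ℚ) (x : ℝ) :
    BddAbove ((fun q : ℚ => (f q : ℝ)) '' {q : ℚ | (q : ℝ) ≤ x}) := by
  obtain ⟨r, hr⟩ := exists_rat_gt x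
  refine ⟨f r, ?_⟩
  rintro _ ⟨q, hq, rfl⟩
  have : (q : ℝ) ≤ r := le_trans hq hr.le
  have h : f q ≤ f r := f.monotone (by exact_mod_cast this)
  change (f q : ℝ) ≤ f r
  exact_mod_cast h

theorem ratExtend_monotone (f : ℚ ≃o ℚ) : Monotone (ratExtend f) := fun x y hxy =>
  csSup_le_csSup (ratExtend_bddAbove f y) (ratExtend_nonempty f x)
    (image_mono fun _ hq => le_trans hq hxy)

theorem ratExtend_ratCast (f : ℚ ≃o ℚ) (q : ℚ) : ratExtend f q = f q := by
  refine IsGreatest.csSup_eq ⟨⟨q, le_refl (q : ℝ), rfl⟩, ?_⟩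
  rintro _ ⟨r, hr, rfl⟩
  have h : f r ≤ f q := f.monotone (by exact_mod_cast (hr : (r : ℝ) ≤ q))
  change (f r : ℝ) ≤ f q
  exact_mod_cast h

/-- A discrepancy at `x` leaves room for a rational, which is some `f q` by surjectivity.
Monotonicity then fails on one side of `q`. This uniqueness makes the extension multiplicative. -/
theorem eq_of_monotone_of_ratCast {S T : ℝ → ℝ} (hS : Monotone S) (hT : Monotone T)
    (f : ℚ ≃o ℚ) (hSf : ∀ q : ℚ, S q = f q) (hTf : ∀ q : ℚ, T q = f q) : S = T := by
  have key : ∀ {S T : ℝ → ℝ}, Monotone S → Monotone T → (∀ q : ℚ, S q = f q) →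
      (∀ q : ℚ, T q = f q) → ∀ x, S x ≤ T x := by
    intro S T hS hT hSf hTf x
    by_contra! h
    obtain ⟨r, hr1, hr2⟩ := exists_rat_btwn h
    obtain ⟨q, rfl⟩ := f.surjective r
    rcases le_total (q : ℝ) x with hq | hq
    · exact hr1.not_ge ((hTf q).symm.trans_le (hT hq))
    · exact hr2.not_ge ((hS hq).trans_eq (hSf q))
  funext x
  exact le_antisymm (key hS hT hSf hTf x) (key hT hS hTf hSf x)

theorem ratExtend_one (x : ℝ) : ratExtend 1 x = x :=
  congrFun (eq_of_monotone_of_ratCast (T := id) (ratExtend_monotone 1) monotone_id 1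
    (ratExtend_ratCast 1) (by simp)) x

theorem ratExtend_mul (f g : ℚ ≃o ℚ) (x : ℝ) :
    ratExtend (f * g) x = ratExtend f (ratExtend g x) :=
  congrFun (eq_of_monotone_of_ratCast (T := ratExtend f ∘ ratExtend g) (ratExtend_monotone _)
    ((ratExtend_monotone f).comp (ratExtend_monotone g)) (f * g)
    (ratExtend_ratCast _) (by simp [ratExtend_ratCast])) x

/-- Increasing bijections of `ℚ` extend to `ℝ`. -/
noncomputable def ratExtendHom : (ℚ ≃o ℚ) →* (ℝ ≃o ℝ) where
  toFun f :=
    { toFun := ratExtend f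
      invFun := ratExtend f⁻¹
      left_inv x := by rw [← ratExtend_mul, inv_mul_cancel, ratExtend_one]
      right_inv x := by rw [← ratExtend_mul, mul_inv_cancel, ratExtend_one]
      map_rel_iff' {x y} := by
        refine ⟨fun h => ?_, fun h => ratExtend_monotone f h⟩
        have := ratExtend_monotone f⁻¹ h
        simpa only [Equiv.coe_fn_mk, ← ratExtend_mul, inv_mul_cancel, ratExtend_one] using this }
  map_one' := by ext x; exact ratExtend_one x
  map_mul' f g := by ext x; exact ratExtend_mul f g x

theorem ratExtendHom_ratCast (f : ℚ ≃o ℚ) (q : ℚ) : ratExtendHom f q = f q :=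
  ratExtend_ratCast f q

namespace LeftOrder

variable {G : Type*} [Group G]

theorem mul_le_mul_left_iff (o : LeftOrder G) (g f h : G) :
    o.le (g * f) (g * h) ↔ o.le f h := by
  refine ⟨fun H => ?_, o.mul_le_mul_left g f h⟩
  simpa using o.mul_le_mul_left g⁻¹ _ _ H

/-- The linear order underlying a left order. -/
noncomputable abbrev toLinearOrder (o : LeftOrder G) : LinearOrder G where
  le := o.le
  le_refl := o.le_refl
  le_trans := o.le_trans
  le_antisymm := o.le_antisymm
  le_total := o.le_total
  toDecidableLE := Classical.decRel _

theorem exists_rat_action [Countable G] [Nontrivial G] (o : LeftOrder G) :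
    ∃ (ρ : G →* (ℚ ≃o ℚ)) (x : ℚ), (∀ g, o.lt 1 g → x < ρ g x) ∧ (∀ y, ∃ g, y < ρ g x) ∧
      (∀ y, ∃ g, ρ g x < y) ∧ ∀ g, g ≠ 1 → ∀ y, ρ g y ≠ y := by
  let _ := o.toLinearOrder
  have : Countable (G ×ₗ ℚ) := inferInstanceAs (Countable (G × ℚ))
  -- The factor `ℚ` makes the order dense and without end points for every `o`, so Cantor's theorem
  -- applies to `G ×ₗ ℚ`, where `G` acts freely by translation.
  obtain ⟨e⟩ := Order.iso_of_countable_dense (G ×ₗ ℚ) ℚ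
  have hlt : ∀ g h : G, g < h ↔ o.lt g h := fun g h => lt_iff_le_and_ne
  have hmul : ∀ g h k : G, g * h < g * k ↔ h < k := fun g h k => by
    rw [hlt, hlt, lt, lt, mul_le_mul_left_iff, ne_eq, mul_right_inj]
  let act (g : G) : (G ×ₗ ℚ) ≃o (G ×ₗ ℚ) :=
    { toFun t := toLex (g * (ofLex t).1, (ofLex t).2)
      invFun t := toLex (g⁻¹ * (ofLex t).1, (ofLex t).2)
      left_inv t := by simp
      right_inv t := by simp
      map_rel_iff' {s t} := by
        change toLex (g * (ofLex s).1, (ofLex s).2) ≤ toLex (g * (ofLex t).1, (ofLex t).2) ↔ s ≤ t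
        rw [Prod.Lex.le_iff, Prod.Lex.le_iff]
        simp [hmul] }
  have hact : ∀ g k q, act g (toLex (k, q)) = toLex (g * k, q) := fun g k q => rfl
  let ρ : G →* (ℚ ≃o ℚ) :=
    { toFun g := e.symm.trans ((act g).trans e)
      map_one' := by
        ext x
        obtain ⟨t, rfl⟩ := e.surjective x
        obtain ⟨⟨k, q⟩, rfl⟩ := toLex.surjective t
        simp [hact]
      map_mul' g h := by
        ext x
        obtain ⟨t, rfl⟩ := e.surjective x
        obtain ⟨⟨k, q⟩, rfl⟩ := toLex.surjective t
        simp [hact, mul_assoc] }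
  have hρ : ∀ g k q, ρ g (e (toLex (k, q))) = e (toLex (g * k, q)) := by
    intro g k q
    simp [ρ, hact]
  obtain ⟨u, hu⟩ : ∃ u : G, 1 < u := by
    obtain ⟨u, hu⟩ := exists_ne (1 : G)
    rcases hu.lt_or_gt with h | h
    · exact ⟨u⁻¹, by simpa using (hmul u⁻¹ _ _).2 h⟩
    · exact ⟨u, h⟩
  have hu' : u⁻¹ < 1 := by simpa using (hmul u⁻¹ _ _).2 hu
  refine ⟨ρ, e (toLex (1, 0)), fun g hg => ?_, fun y => ?_, fun y => ?_, fun g hg y => ?_⟩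
  · rw [hρ, e.lt_iff_lt, Prod.Lex.lt_iff]
    exact Or.inl (by simpa [hlt] using hg)
  · obtain ⟨t, rfl⟩ := e.surjective y
    obtain ⟨⟨k, q⟩, rfl⟩ := toLex.surjective t
    refine ⟨k * u, ?_⟩
    rw [hρ, e.lt_iff_lt, Prod.Lex.lt_iff]
    exact Or.inl (by simpa using (hmul k _ _).2 hu)
  · obtain ⟨t, rfl⟩ := e.surjective y
    obtain ⟨⟨k, q⟩, rfl⟩ := toLex.surjective t
    refine ⟨k * u⁻¹, ?_⟩
    rw [hρ, e.lt_iff_lt, Prod.Lex.lt_iff]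
    exact Or.inl (by simpa using (hmul k _ _).2 hu')
  · obtain ⟨t, rfl⟩ := e.surjective y
    obtain ⟨⟨k, q⟩, rfl⟩ := toLex.surjective t
    rw [hρ, ne_eq, e.injective.eq_iff, toLex.injective.eq_iff]
    simpa using hg

/-- The dynamical realisation of a left order. -/
theorem exists_real_action [Countable G] [Nontrivial G] (o : LeftOrder G) :
    ∃ (ρ : G →* (ℝ ≃o ℝ)) (x : ℝ), (∀ g, o.lt 1 g → x < ρ g x) ∧ (∀ s, ∃ g, ρ g s ≠ s) ∧
      ∀ g, g ≠ 1 → ∀ q : ℚ, ρ g q ≠ q := by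
  obtain ⟨ρ, x, h1, h2, h3, h4⟩ := o.exists_rat_action
  have hρ : ∀ g (q : ℚ), (ratExtendHom.comp ρ) g q = ρ g q := fun g q => ratExtendHom_ratCast _ _
  refine ⟨ratExtendHom.comp ρ, x, fun g hg => ?_, fun s => ?_, fun g hg q => ?_⟩
  · rw [hρ]
    exact_mod_cast h1 g hg
  · by_contra! H
    rcases le_or_gt (x : ℝ) s with hx | hx
    · obtain ⟨y, hy⟩ := exists_rat_gt s
      obtain ⟨g, hg⟩ := h2 y
      have h5 := ((ratExtendHom.comp ρ) g).monotone hx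
      rw [hρ, H] at h5
      have h6 : (y : ℝ) < ρ g x := by exact_mod_cast hg
      linarith
    · obtain ⟨y, hy⟩ := exists_rat_lt s
      obtain ⟨g, hg⟩ := h3 y
      have h5 := ((ratExtendHom.comp ρ) g).monotone hx.le
      rw [hρ, H] at h5
      have h6 : (ρ g x : ℝ) < y := by exact_mod_cast hg
      linarith
  · rw [hρ]
    exact_mod_cast h4 g hg q

/-- The left order given by the orbit of a point of an action, refined by another left order. -/
def ofAction (o : LeftOrder G) (ρ : G →* (ℝ ≃o ℝ)) (x : ℝ) : LeftOrder G where
  le g h := ρ g x < ρ h x ∨ ρ g x = ρ h x ∧ o.le g h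
  le_refl g := Or.inr ⟨rfl, o.le_refl g⟩
  le_trans f g h := by
    rintro (h1 | ⟨h1, h1'⟩) (h2 | ⟨h2, h2'⟩)
    · exact Or.inl (h1.trans h2)
    · exact Or.inl (h1.trans_eq h2)
    · exact Or.inl (h1.trans_lt h2)
    · exact Or.inr ⟨h1.trans h2, o.le_trans _ _ _ h1' h2'⟩
  le_antisymm f g := by
    rintro (h1 | ⟨h1, h1'⟩) (h2 | ⟨h2, h2'⟩)
    · exact absurd h1 h2.not_gt
    · exact absurd h2 h1.ne'
    · exact absurd h1 h2.ne'
    · exact o.le_antisymm _ _ h1' h2'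
  le_total f g := by
    rcases lt_trichotomy (ρ f x) (ρ g x) with h | h | h
    · exact Or.inl (Or.inl h)
    · exact (o.le_total f g).imp (fun h' => Or.inr ⟨h, h'⟩) fun h' => Or.inr ⟨h.symm, h'⟩
    · exact Or.inr (Or.inl h)
  mul_le_mul_left g f h := by
    simp only [map_mul, RelIso.mul_apply, OrderIso.lt_iff_lt, EmbeddingLike.apply_eq_iff_eq]
    exact Or.imp_right (And.imp_right (o.mul_le_mul_left g f h))

theorem ofAction_lt_one (o : LeftOrder G) (ρ : G →* (ℝ ≃o ℝ)) (x : ℝ) {g : G}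
    (hg : x < ρ g x) : (o.ofAction ρ x).lt 1 g := by
  refine ⟨Or.inl (by simpa using hg), ?_⟩
  rintro rfl
  simp at hg

/-- The pullback of a left order along an injective homomorphism. -/
def comap {G K : Type*} [Group G] [Group K] (o : LeftOrder K) (f : G →* K)
    (hf : Function.Injective f) : LeftOrder G where
  le x y := o.le (f x) (f y)
  le_refl _ := o.le_refl _
  le_trans _ _ _ := o.le_trans _ _ _
  le_antisymm _ _ h h' := hf (o.le_antisymm _ _ h h')
  le_total _ _ := o.le_total _ _
  mul_le_mul_left g x y h := by simpa using o.mul_le_mul_left (f g) _ _ h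

/-- The sign in `ℤ` decides first. Two elements are compared inside `N` only when their `ℤ` parts
are trivial, and there the twist is trivial, so `φ` need not preserve `o`. -/
theorem nonempty_semidirectProduct_int {N : Type*} [Group N] (o : LeftOrder N)
    (φ : Multiplicative ℤ →* MulAut N) : Nonempty (LeftOrder (N ⋊[φ] Multiplicative ℤ)) := by
  refine ⟨ofPos (fun g => 1 < g.right ∨ g.right = 1 ∧ o.lt 1 g.left) ?_ ?_ ?_⟩
  · simp [o.not_lt_one_one]
  · intro g hg
    by_cases hr : g.right = 1
    · have hl : g.left ≠ 1 := fun hl => hg (SemidirectProduct.ext hl hr)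
      simp [hr, o.lt_one_inv_iff hl]
    · simp only [SemidirectProduct.inv_right, one_lt_inv', inv_eq_one, hr, false_and, or_false,
        not_lt]
      exact ⟨le_of_lt, fun h => lt_of_le_of_ne h hr⟩
  · intro g h
    simp only [SemidirectProduct.mul_right, SemidirectProduct.mul_left]
    rintro (hg | ⟨hg, hg'⟩) (hh | ⟨hh, hh'⟩)
    · exact Or.inl (one_lt_mul'' hg hh)
    · exact Or.inl (by simpa [hh] using hg)
    · exact Or.inl (by simpa [hg] using hh)
    · exact Or.inr (by simpa [hg, hh] using o.lt_one_mul hg' hh')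

/-- A group whose elements are separated by actions on `ℚ` is left-orderable. -/
theorem nonempty_of_actions {G : Type*} [Group G]
    (h : ∀ g : G, g ≠ 1 → ∃ (ρ : G →* (ℚ ≃o ℚ)) (x : ℚ), ρ g x ≠ x) :
    Nonempty (LeftOrder G) := by
  -- With all pairs of an action and a point well-ordered, two elements are compared at the first
  -- pair where they differ.
  obtain ⟨_, _⟩ := exists_wellFoundedLT ((G →* (ℚ ≃o ℚ)) × ℚ)
  let E (g : G) : Lex ((G →* (ℚ ≃o ℚ)) × ℚ → ℚ) := toLex fun i => i.1 g i.2
  have hE : Function.Injective E := by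
    intro g k hgk
    by_contra hne
    obtain ⟨ρ, x, hx⟩ := h (k⁻¹ * g) (by rwa [ne_eq, inv_mul_eq_one, eq_comm])
    refine hx ?_
    have := congrFun (toLex.injective hgk) (ρ, x)
    simp only at this
    simp [this]
  have hmul : ∀ g h k, E h < E k → E (g * h) < E (g * k) := by
    rintro g h k ⟨i, hi, hi'⟩
    refine ⟨i, fun j hj => ?_, ?_⟩
    · have := hi j hj
      change j.1 (g * h) j.2 = j.1 (g * k) j.2
      change j.1 h j.2 = j.1 k j.2 at this
      simp [this]
    · change i.1 (g * h) i.2 < i.1 (g * k) i.2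
      change i.1 h i.2 < i.1 k i.2 at hi'
      simpa using hi'
  exact ⟨{
    le := fun g k => E g ≤ E k
    le_refl := fun _ => _root_.le_rfl
    le_trans := fun _ _ _ => _root_.le_trans
    le_antisymm := fun _ _ h h' => hE (_root_.le_antisymm h h')
    le_total := fun _ _ => _root_.le_total _ _
    mul_le_mul_left := fun g h k hk => by
      rcases hk.eq_or_lt with hk | hk
      · rw [hE hk]
      · exact (hmul g h k hk).le }⟩

end LeftOrder

/-! ### Left-orderability of free groups. -/

/-- Every finite partial isomorphism of `ℚ` extends to an automorphism. -/
theorem Order.PartialIso.exists_orderIso (S : Order.PartialIso ℚ ℚ) :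
    ∃ f : ℚ ≃o ℚ, ∀ p ∈ S.val, f p.1 = p.2 := by
  let to_cofinal : ℚ ⊕ ℚ → Order.Cofinal (Order.PartialIso ℚ ℚ) := fun p =>
    Sum.recOn p (definedAtLeft ℚ) (definedAtRight ℚ)
  let I : Order.Ideal (Order.PartialIso ℚ ℚ) := Order.idealOfCofinals S to_cofinal
  have hS : S ∈ I := Order.mem_idealOfCofinals S to_cofinal
  let F a := funOfIdeal a I (Order.cofinal_meets_idealOfCofinals _ to_cofinal (Sum.inl a))
  let G b := invOfIdeal b I (Order.cofinal_meets_idealOfCofinals _ to_cofinal (Sum.inr b))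
  refine ⟨OrderIso.ofCmpEqCmp (fun a => (F a).val) (fun b => (G b).val) fun a b => ?_,
    fun p hp => ?_⟩
  · obtain ⟨f, hf, ha⟩ := (F a).prop
    obtain ⟨g, hg, hb⟩ := (G b).prop
    obtain ⟨m, _, fm, gm⟩ := I.directed _ hf _ hg
    exact m.prop (a, _) (fm ha) (_, b) (gm hb)
  · change (F p.1).val = p.2
    obtain ⟨f, hf, ha⟩ := (F p.1).prop
    obtain ⟨m, _, fm, Sm⟩ := I.directed _ hf _ hS
    have := m.prop _ (fm ha) _ (Sm hp)
    rw [cmp_self_eq_eq, eq_comm, cmp_eq_eq_iff] at this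
    exact this

namespace FreeGroup

variable {α : Type*}

/-- The pair of points moved by the letter of position `j` of a word `L`, which maps `-(j + 1)`
to `-j`. -/
def letterPair (L : List (α × Bool)) (j : Fin L.length) : ℚ × ℚ :=
  if L[j].2 then (-((j : ℕ) + 1), -(j : ℕ)) else (-(j : ℕ), -((j : ℕ) + 1))

/-- Pairs with equal exponents are translates by the same unit. With opposite exponents the
comparison could fail only for `j` and `k` equal or adjacent, which reducedness excludes. -/
theorem cmp_letterPair {L : List (α × Bool)} (hL : IsReduced L) (j k : Fin L.length)
    (hjk : L[j].1 = L[k].1) :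
    cmp (letterPair L j).1 (letterPair L k).1 = cmp (letterPair L j).2 (letterPair L k).2 := by
  have hchain : ∀ j k : Fin L.length, (k : ℕ) = j + 1 → L[j].1 = L[k].1 → L[j].2 = L[k].2 := by
    intro j k hk h
    have := List.isChain_iff_getElem.1 hL j (hk ▸ k.2)
    simp only [Fin.getElem_fin, hk] at h ⊢
    exact this h
  have hne1 : L[j].2 ≠ L[k].2 → (k : ℕ) ≠ j + 1 := fun h hk => h (hchain j k hk hjk)
  have hne2 : L[j].2 ≠ L[k].2 → (j : ℕ) ≠ k + 1 := fun h hk => h (hchain k j hk hjk.symm).symm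
  have hne3 : L[j].2 ≠ L[k].2 → (j : ℕ) ≠ k := fun h hk => h (by rw [Fin.ext hk])
  have hcast : ∀ a b c d : ℤ, cmp a b = cmp c d → cmp (a : ℚ) b = cmp (c : ℚ) d := by
    intro a b c d h
    rwa [Int.cast_strictMono.cmp_map_eq, Int.cast_strictMono.cmp_map_eq]
  have hint : ∀ a b c d : ℤ, (a < b ↔ c < d) → (b < a ↔ d < c) → cmp a b = cmp c d := by
    intro a b c d h1 h2
    simp only [cmp, cmpUsing, h1, h2]
  rcases hj : L[j].2 <;> rcases hk : L[k].2 <;> simp only [letterPair, hj, hk] <;>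
    simp only [if_true, if_false, Bool.false_eq_true, ne_eq, not_true_eq_false, not_false_eq_true,
      forall_const, hj, hk, reduceCtorEq] at hne1 hne2 hne3 ⊢
  · simp
  · have := hcast (-(j : ℕ)) (-((k : ℕ) + 1)) (-((j : ℕ) + 1)) (-(k : ℕ))
      (hint _ _ _ _ (by omega) (by omega))
    simpa using this
  · have := hcast (-((j : ℕ) + 1)) (-(k : ℕ)) (-(j : ℕ)) (-((k : ℕ) + 1))
      (hint _ _ _ _ (by omega) (by omega))
    simpa using this
  · simp

/-- The letters, applied from the right, climb from `-(j + L.length)` to `-j` one unit at a time. -/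
theorem prod_apply_of_forall_letter (f : α → ℚ ≃o ℚ) (L : List (α × Bool)) (j : ℕ)
    (h : ∀ (i : ℕ) (hi : i < L.length), (cond L[i].2 (f L[i].1) (f L[i].1)⁻¹)
      (-((j + i : ℕ) + 1)) = -(j + i : ℕ)) :
    (L.map fun x => cond x.2 (f x.1) (f x.1)⁻¹).prod (-((j + L.length : ℕ) : ℚ)) = -(j : ℚ) := by
  induction L generalizing j with
  | nil => simp
  | cons a L ih =>
    have h1 := ih (j + 1) fun i hi => by
      have := h (i + 1) (by simpa using hi)
      simp only [List.getElem_cons_succ] at this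
      rw [show j + 1 + i = j + (i + 1) by ring]
      exact this
    have h2 := h 0 (by simp)
    simp only [List.getElem_cons_zero, add_zero] at h2
    rw [List.map_cons, List.prod_cons, RelIso.mul_apply, List.length_cons,
      show j + (L.length + 1) = j + 1 + L.length by ring, h1, Nat.cast_add, Nat.cast_one, h2]

theorem exists_rat_action {w : FreeGroup α} (hw : w ≠ 1) :
    ∃ (ρ : FreeGroup α →* (ℚ ≃o ℚ)) (x : ℚ), ρ w x ≠ x := by
  classical
  set L := w.toWord with hL
  have hred : IsReduced L := isReduced_toWord
  have hex (a : α) : ∃ f : ℚ ≃o ℚ, ∀ j : Fin L.length, L[j].1 = a →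
      f (letterPair L j).1 = (letterPair L j).2 := by
    obtain ⟨f, hf⟩ := Order.PartialIso.exists_orderIso
      ⟨({j | L[j].1 = a} : Finset (Fin L.length)).image (letterPair L), by
        intro p hp q hq
        simp only [Finset.mem_image, Finset.mem_filter, Finset.mem_univ, true_and] at hp hq
        obtain ⟨j, hj, rfl⟩ := hp
        obtain ⟨k, hk, rfl⟩ := hq
        exact cmp_letterPair hred j k (hj.trans hk.symm)⟩
    exact ⟨f, fun j hj => hf _ (Finset.mem_image.2 ⟨j, by simpa using hj, rfl⟩)⟩
  choose f hf using hex
  refine ⟨lift f, -(L.length : ℕ), ?_⟩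
  have key := prod_apply_of_forall_letter f L 0 fun i hi => by
    have h := hf _ ⟨i, hi⟩ rfl
    simp only [letterPair, Fin.getElem_fin] at h
    rw [zero_add]
    rcases hb : L[i].2 with _ | _
    · simp only [hb, Bool.false_eq_true, if_false] at h
      simp only [cond_false]
      rw [← h]
      simp
    · simp only [hb, if_true] at h
      exact h
  rw [← lift_mk, hL, mk_toWord, ← hL] at key
  simp only [zero_add, Nat.cast_zero, neg_zero] at key
  rw [key]
  have : L.length ≠ 0 := by
    rw [ne_eq, List.length_eq_zero_iff, hL, toWord_eq_nil_iff]
    exact hw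
  simpa [eq_comm] using this

theorem nonempty_leftOrder : Nonempty (LeftOrder (FreeGroup α)) :=
  LeftOrder.nonempty_of_actions fun _ => exists_rat_action

end FreeGroup

/-! ### Left-orderability of surface groups via the infinite cyclic cover. -/

namespace SurfaceCover

variable (n : ℕ)

/-- The fundamental group of the infinite cyclic cover of a surface of genus `n + 1`: a free group
on one generator, and on `ℤ` copies of the generators of the other handles. -/
abbrev Cover : Type := FreeGroup (Option ((Fin n ⊕ Fin n) × ℤ))

variable {n}

/-- The copy with index `k` of a generator. -/
def gen (i : Fin n ⊕ Fin n) (k : ℤ) : Cover n := FreeGroup.of (some (i, k))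

/-- The generator without copies. -/
def base : Cover n := FreeGroup.of none

variable (n) in
/-- The copy with index `k` of the product of the commutators of the other handles. -/
def tail (k : ℤ) : Cover n :=
  (List.ofFn fun i : Fin n => gen (Sum.inl i) k * gen (Sum.inr i) k * (gen (Sum.inl i) k)⁻¹ *
    (gen (Sum.inr i) k)⁻¹).prod

/-- The homomorphism that adds `d` to the indices and maps `base` to `x`. -/
def shiftHom (x : Cover n) (d : ℤ) : Cover n →* Cover n :=
  FreeGroup.lift fun t => t.elim x fun p => gen p.1 (p.2 + d)

theorem shiftHom_gen (x : Cover n) (d : ℤ) (i : Fin n ⊕ Fin n) (k : ℤ) :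
    shiftHom x d (gen i k) = gen i (k + d) := by simp [shiftHom, gen]

theorem shiftHom_base (x : Cover n) (d : ℤ) : shiftHom x d base = x := by
  simp [shiftHom, base]

theorem shiftHom_tail (x : Cover n) (d k : ℤ) : shiftHom x d (tail n k) = tail n (k + d) := by
  simp [tail, map_list_prod, List.map_ofFn, Function.comp_def, shiftHom_gen]

theorem hom_ext {H : Type*} [Group H] {f g : Cover n →* H} (hbase : f base = g base)
    (hgen : ∀ i k, f (gen i k) = g (gen i k)) : f = g := by
  refine FreeGroup.ext_hom _ _ fun t => ?_
  rcases t with _ | ⟨i, k⟩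
  · exact hbase
  · exact hgen i k

variable (n) in
/-- The deck transformation. -/
def deck : MulAut (Cover n) :=
  MonoidHom.toMulEquiv (shiftHom ((tail n 0)⁻¹ * base) 1) (shiftHom (tail n (-1) * base) (-1))
    (hom_ext (by simp [shiftHom_base, shiftHom_tail]) (by simp [shiftHom_gen]))
    (hom_ext (by simp [shiftHom_base, shiftHom_tail]) (by simp [shiftHom_gen]))

theorem deck_apply (x : Cover n) : deck n x = shiftHom ((tail n 0)⁻¹ * base) 1 x := rfl

variable (n) in
/-- The semidirect product with the deck transformation. -/
abbrev Model : Type := Cover n ⋊[zpowersHom _ (deck n)] Multiplicative ℤ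

/-- The generators of the surface group in the semidirect product. -/
def toModelGen : Fin (n + 1) ⊕ Fin (n + 1) → Model n :=
  Sum.elim
    (Fin.cons (SemidirectProduct.inr (Multiplicative.ofAdd 1))
      fun i => SemidirectProduct.inl (gen (Sum.inl i) 0))
    (Fin.cons (SemidirectProduct.inl base) fun i => SemidirectProduct.inl (gen (Sum.inr i) 0))

theorem lift_toModelGen : FreeGroup.lift (toModelGen (n := n)) (surfaceRelator (n + 1)) = 1 := by
  have h1 : FreeGroup.lift (toModelGen (n := n)) (surfaceTail n) =
      SemidirectProduct.inl (tail n 0) := by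
    rw [lift_surfaceTail]
    simp [toModelGen, tail, map_list_prod, List.map_ofFn, Function.comp_def]
  have h2 := SemidirectProduct.inl_aut (φ := zpowersHom _ (deck n)) (Multiplicative.ofAdd 1) base
  rw [zpowersHom_apply, toAdd_ofAdd, zpow_one, deck_apply, shiftHom_base, _root_.map_inv] at h2
  rw [lift_surfaceRelator, h1]
  change SemidirectProduct.inr (Multiplicative.ofAdd 1) * SemidirectProduct.inl base *
    (SemidirectProduct.inr (Multiplicative.ofAdd 1))⁻¹ * (SemidirectProduct.inl base)⁻¹ * _ = 1
  rw [← h2, ← _root_.map_inv, ← map_mul, ← map_mul]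
  simp

/-- The homomorphism from the surface group to the semidirect product. -/
def toModel : SurfaceGroup (n + 1) →* Model n :=
  PresentedGroup.toGroup (f := toModelGen) (by simpa using lift_toModelGen)

/-- The generators of the surface group. -/
abbrev sgen (i : Fin (n + 1) ⊕ Fin (n + 1)) : SurfaceGroup (n + 1) := PresentedGroup.of i

theorem toModel_sgen (i : Fin (n + 1) ⊕ Fin (n + 1)) : toModel (sgen i) = toModelGen i :=
  PresentedGroup.toGroup.of _

/-- The homomorphism from the cover to the surface group. -/
def ofCover : Cover n →* SurfaceGroup (n + 1) :=
  FreeGroup.lift fun t => t.elim (sgen (Sum.inr 0)) fun p =>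
    sgen (Sum.inl 0) ^ p.2 * sgen (p.1.map Fin.succ Fin.succ) * (sgen (Sum.inl 0) ^ p.2)⁻¹

theorem ofCover_base : ofCover (n := n) base = sgen (Sum.inr 0) := by simp [ofCover, base]

theorem ofCover_gen (i : Fin n ⊕ Fin n) (k : ℤ) : ofCover (gen i k) =
    sgen (Sum.inl 0) ^ k * sgen (i.map Fin.succ Fin.succ) * (sgen (Sum.inl 0) ^ k)⁻¹ := by
  simp [ofCover, gen]

theorem mk_eq_lift_sgen (w : FreeGroup (Fin (n + 1) ⊕ Fin (n + 1))) :
    PresentedGroup.mk ({surfaceRelator (n + 1)} : Set _) w = FreeGroup.lift sgen w := by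
  have : PresentedGroup.mk ({surfaceRelator (n + 1)} : Set _) = FreeGroup.lift sgen :=
    FreeGroup.ext_hom _ _ fun i => by simp [sgen, PresentedGroup.of]
  rw [this]

/-- On `base` this is the relator itself, rewritten as `a b a⁻¹ = tail⁻¹ b` for the first handle. On
the indexed generators it is the shift of the exponent of `a`. -/
theorem ofCover_deck (x : Cover n) :
    ofCover (deck n x) = sgen (Sum.inl 0) * ofCover x * (sgen (Sum.inl 0))⁻¹ := by
  have htail : ofCover (tail n 0) = FreeGroup.lift sgen (surfaceTail n) := by
    rw [lift_surfaceTail]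
    simp [tail, map_list_prod, List.map_ofFn, Function.comp_def, ofCover_gen]
  have hrel : FreeGroup.lift (sgen (n := n)) (surfaceRelator (n + 1)) = 1 := by
    rw [← mk_eq_lift_sgen]
    exact PresentedGroup.one_of_mem rfl
  rw [lift_surfaceRelator, ← htail] at hrel
  have : ofCover.comp (deck n).toMonoidHom =
      (MulAut.conj (sgen (n := n) (Sum.inl 0))).toMonoidHom.comp ofCover := by
    refine hom_ext ?_ fun i k => ?_
    · simp only [MonoidHom.comp_apply, MulEquiv.coe_toMonoidHom, deck_apply, shiftHom_base,
        map_mul, _root_.map_inv, ofCover_base, MulAut.conj_apply]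
      rw [← eq_inv_of_mul_eq_one_left hrel]
      group
    · simp only [MonoidHom.comp_apply, MulEquiv.coe_toMonoidHom, deck_apply, shiftHom_gen,
        ofCover_gen, MulAut.conj_apply]
      group
  exact DFunLike.congr_fun this x

theorem ofCover_deck_zpow (k : ℤ) (x : Cover n) :
    ofCover ((deck n ^ k) x) = sgen (Sum.inl 0) ^ k * ofCover x * (sgen (Sum.inl 0) ^ k)⁻¹ := by
  induction k with
  | zero => simp
  | succ k ih =>
    rw [add_comm (k : ℤ) 1, zpow_one_add, zpow_one_add, MulAut.mul_apply, ofCover_deck, ih]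
    group
  | pred k ih =>
    have h := ofCover_deck ((deck n ^ (-(k : ℤ) - 1)) x)
    rw [← MulAut.mul_apply, ← zpow_one_add, add_sub_cancel, ih] at h
    rw [← mul_right_inj, ← mul_left_inj, ← h]
    group

/-- The homomorphism from the semidirect product to the surface group. -/
def ofModel : Model n →* SurfaceGroup (n + 1) :=
  SemidirectProduct.lift ofCover (zpowersHom _ (sgen (Sum.inl 0))) fun g => by
    refine MonoidHom.ext fun x => ?_
    simp only [MonoidHom.comp_apply, MulEquiv.coe_toMonoidHom, zpowersHom_apply,
      ofCover_deck_zpow, MulAut.conj_apply]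

/-- `ofModel` is a left inverse, as can be checked on generators. -/
theorem toModel_injective : Function.Injective (toModel (n := n)) := by
  have : ofModel.comp (toModel (n := n)) = MonoidHom.id _ := by
    refine PresentedGroup.ext fun i => ?_
    change ofModel (toModel (sgen i)) = sgen i
    rw [toModel_sgen]
    rcases i with i | i <;> refine Fin.cases ?_ (fun i => ?_) i <;>
      simp [toModelGen, ofModel, ofCover_base, ofCover_gen, zpowersHom_apply]
  exact Function.LeftInverse.injective (g := ofModel) (DFunLike.congr_fun this)

theorem nonempty_leftOrder : Nonempty (LeftOrder (SurfaceGroup (n + 1))) := by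
  obtain ⟨o⟩ := FreeGroup.nonempty_leftOrder (α := Option ((Fin n ⊕ Fin n) × ℤ))
  obtain ⟨o'⟩ := o.nonempty_semidirectProduct_int (zpowersHom _ (deck n))
  exact ⟨o'.comap toModel toModel_injective⟩

/-- The first generator maps to the generator of `ℤ`. -/
theorem sgen_ne_one : sgen (n := n) (Sum.inl 0) ≠ 1 := by
  intro h
  have h1 := toModel_sgen (n := n) (Sum.inl 0)
  rw [h, map_one] at h1
  have h2 := congrArg SemidirectProduct.right h1
  have h3 : (1 : Multiplicative ℤ) = Multiplicative.ofAdd 1 := h2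
  exact absurd (congrArg Multiplicative.toAdd h3) (by simp)

end SurfaceCover

/-! ### Topological transitivity and conclusion. -/

-- Both orders are realised on the line, the actions are joined, and the order is read off from the
-- orbit of `x₁`. Ties in the orbit are broken by `o₁`, whose choice does not matter.
open SurfaceCover in
theorem exists_leftOrder_conj_of_finset (n : ℕ) (o₁ o₂ : LeftOrder (SurfaceGroup (n + 2)))
    (F₁ F₂ : Finset (SurfaceGroup (n + 2))) (h₁ : ∀ g ∈ F₁, o₁.lt 1 g)
    (h₂ : ∀ g ∈ F₂, o₂.lt 1 g) : ∃ (o : LeftOrder (SurfaceGroup (n + 2))) (k : _),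
      (∀ g ∈ F₁, o.lt 1 g) ∧ ∀ g ∈ F₂, (o.conj k).lt 1 g := by
  classical
  have : Countable (SurfaceGroup (n + 2)) :=
    (PresentedGroup.mk_surjective ({surfaceRelator (n + 2)} : Set _)).countable
  have : Nontrivial (SurfaceGroup (n + 2)) := ⟨_, _, sgen_ne_one⟩
  obtain ⟨ρ₁, x₁, hpos₁, hfix₁, hfree₁⟩ := o₁.exists_real_action
  obtain ⟨ρ₂, x₂, hpos₂, hfix₂, hfree₂⟩ := o₂.exists_real_action
  have hlift : ∀ (ρ : SurfaceGroup (n + 2) →* (ℝ ≃o ℝ)) (w : _),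
      FreeGroup.lift (fun i => ρ (sgen i)) w = ρ (PresentedGroup.mk _ w) := by
    intro ρ w
    have : FreeGroup.lift (fun i => ρ (sgen i)) = ρ.comp (PresentedGroup.mk _) :=
      FreeGroup.ext_hom _ _ fun i => by simp [sgen, PresentedGroup.of]
    rw [this]
    rfl
  have hrel : ∀ ρ : SurfaceGroup (n + 2) →* (ℝ ≃o ℝ),
      FreeGroup.lift (fun i => ρ (sgen i)) (surfaceRelator (n + 2)) = 1 := fun ρ => by
    have h : PresentedGroup.mk ({surfaceRelator (n + 2)} : Set _) (surfaceRelator (n + 2)) = 1 :=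
      PresentedGroup.one_of_mem rfl
    rw [hlift, h, map_one]
  have hfix : ∀ ρ : SurfaceGroup (n + 2) →* (ℝ ≃o ℝ), (∀ s, ∃ g, ρ g s ≠ s) →
      ∀ s, ∃ i, ρ (sgen i) s ≠ s := by
    intro ρ h s
    by_contra! H
    obtain ⟨g, hg⟩ := h s
    obtain ⟨w, rfl⟩ := PresentedGroup.mk_surjective _ g
    refine hg ?_
    rw [← hlift]
    exact LineHomeo.lift_apply_of_forall_fixed H w
  choose c hc using PresentedGroup.mk_surjective ({surfaceRelator (n + 2)} : Set _)
  obtain ⟨φ, hφ, hφ₁, W, hφ₂⟩ := LineHomeo.exists_joint_action n (fun i => ρ₁ (sgen i))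
    (fun i => ρ₂ (sgen i)) (hrel ρ₁) (hrel ρ₂) (hfix ρ₁ hfix₁) (hfix ρ₂ hfix₂)
    -- In a dynamical realisation a nontrivial element moves every rational, so the first generator
    -- moves points arbitrarily far in both directions.
    (fun y => by
      obtain ⟨q, hq⟩ := exists_rat_gt y
      exact ⟨q, hq.le, hfree₁ _ sgen_ne_one q⟩)
    (fun y => by
      obtain ⟨q, hq⟩ := exists_rat_lt y
      exact ⟨q, hq.le, hfree₂ _ sgen_ne_one q⟩) x₁ x₂ (F₁.image c) (F₂.image c)
    (by
      intro w hw
      obtain ⟨g, hg, rfl⟩ := Finset.mem_image.1 hw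
      rw [hlift, hc]
      exact hpos₁ g (h₁ g hg))
    (by
      intro w hw
      obtain ⟨g, hg, rfl⟩ := Finset.mem_image.1 hw
      rw [hlift, hc]
      exact hpos₂ g (h₂ g hg))
  let ρ : SurfaceGroup (n + 2) →* (ℝ ≃o ℝ) :=
    PresentedGroup.toGroup (f := φ) (by simpa using hφ)
  have hρ : ∀ w, ρ (PresentedGroup.mk _ w) = FreeGroup.lift φ w := fun w => rfl
  -- Conjugating by `W⁻¹` shifts the base point to `W x₁`: `W⁻¹ g W` moves `x₁` to the right exactly
  -- when `g` moves `W x₁` to the right.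
  refine ⟨o₁.ofAction ρ x₁, (PresentedGroup.mk _ W)⁻¹, fun g hg => ?_, fun g hg => ?_⟩
  · refine o₁.ofAction_lt_one ρ x₁ ?_
    rw [← hc g, hρ]
    exact hφ₁ _ (Finset.mem_image_of_mem _ hg)
  · rw [LeftOrder.conj_lt_one]
    refine o₁.ofAction_lt_one ρ x₁ ?_
    have h := hφ₂ _ (Finset.mem_image_of_mem _ hg)
    rw [← hρ, ← hρ, hc] at h
    have h' := (ρ (PresentedGroup.mk _ W))⁻¹.strictMono h
    simpa using h'

theorem mainTheorem6 (q : ℕ) (hq : 2 ≤ q) :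
    ∃ o : LeftOrder (SurfaceGroup q), Dense o.conjOrbit := by
  obtain ⟨n, rfl⟩ := Nat.exists_eq_add_of_le' hq
  have : Nonempty (LeftOrder (SurfaceGroup (n + 2))) := SurfaceCover.nonempty_leftOrder
  have : Countable (SurfaceGroup (n + 2)) :=
    (PresentedGroup.mk_surjective ({surfaceRelator (n + 2)} : Set _)).countable
  exact LeftOrder.exists_dense_conjOrbit (exists_leftOrder_conj_of_finset n)
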